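/- Let $\pi:A\to M$ be a smooth real vector bundle of finite rank $n\ge 1$ over a smooth manifold $M$, with dual bundle $\pi^*:A^*\to M$ and space of smooth sections $\Gamma(A)$. A function on the manifold $A^*$ is called linear if it is smooth and linear on every fibre (equivalently, it is $\tilde\mu$ for some $\mu\in\Gamma(A)$, where $\tilde\mu(\alpha)=\alpha(\mu(x))$ for $\alpha\in A^*_x$), and basic if it is of the form $\bar f\circ\pi^*$ with $\bar f\in C^\infty(M,\mathbb R)$. A Jacobi structure on a manifold $N$ is a pair $(\Lambda,E)$ of a 2-vector and a vector field on $N$ with $[\Lambda,\Lambda]_{SN}=2E\wedge\Lambda$ and $[E,\Lambda]_{SN}=0$, where the sign of the Schouten-Nijenhuis bracket is such that $[\Lambda,\Lambda]_{SN}(df,dg,dh)=2\bigl(\Lambda(d(\Lambda(df,dg)),dh)+\Lambda(d(\Lambda(dg,dh)),df)+\Lambda(d(\Lambda(dh,df)),dg)\bigr)$ and $[E,\Lambda]_{SN}=\mathcal L_E\Lambda$. Its Jacobi bracket is $\{f,g\}=\Lambda(df,dg)+fE(g)-gE(f)$. Let $(\Lambda,E)$ be a Jacobi structure on $A^*$ such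 that (C1) the Jacobi bracket of two linear functions is linear; (C2) the Jacobi bracket of a linear function and the constant function $1$ is basic. Then there are a Lie algebroid structure $([\![\,,]\!],\rho)$ on $\pi:A\to M$ and a 1-cocycle $\phi\in\Gamma(A^*)$ for it, i.e. $\phi([\![\mu,\eta]\!])=\rho(\mu)(\phi(\eta))-\rho(\eta)(\phi(\mu))$ for all $\mu,\eta\in\Gamma(A)$, such that $$\Lambda=\Lambda_{(A^*,\phi)}:=\Lambda_{A^*}+\Delta\wedge\phi^v,\qquad E=E_{(A^*,\phi)}:=-\phi^v .$$ Here $\Delta$ is the Liouville vector field of $A^*$, $\phi^v$ is the vertical lift of $\phi$, $(X\wedge Y)(\alpha,\beta)=\alpha(X)\beta(Y)-\alpha(Y)\beta(X)$, and $\Lambda_{A^*}$ is the 2-vector given, in the coordinates $(x^l,\mu_j=\tilde e_j)$ of $A^*$ defined by local coordinates $(x^l)$ of $M$ and a local frame $(e_i)$ of $A$ with $[\![e_i,e_j]\!]=\sum_k c_{ij}^k e_k$ and $\rho(e_i)=\sum_l\rho_i^l\,\partial/\partial x^l$, by $$\Lambda_{A^*}=\sum_{i<j}\sum_k c_{ij}^k\mu_k\frac{\partial}{\partial\mu_i}\wedge\frac{\partial}{\partial\mu_j}+\sum_{i,l}\rho_i^l\frac{\partial}{\partial\mu_i}\wedge\frac{\partial}{\partial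 x^l}.$$ -/

import Mathlib

open Bundle Manifold
open scoped ContDiff Manifold Topology

noncomputable section

/-! ### Jacobi structures on a manifold -/

section JacobiStructures

variable {E : Type*} [NormedAddCommGroup E] [NormedSpace ℝ E] {H : Type*} [TopologicalSpace H]
  (J : ModelWithCorners ℝ E H) {N : Type*} [TopologicalSpace N] [ChartedSpace H N]

/-- Elements of `Λ²(T_p N)`, `N` finite-dimensional, are regarded as bilinear forms on `T_p^* N`
(those that occur are alternating). -/
abbrev TwoVectorAt (p : N) : Type _ :=
  (TangentSpace J p →L[ℝ] ℝ) →ₗ[ℝ] (TangentSpace J p →L[ℝ] ℝ) →ₗ[ℝ] ℝ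

/-- The 2-vector `X ∧ Y`, `(X ∧ Y)(α, β) = α(X) β(Y) - α(Y) β(X)`. -/
def wedge {p : N} (X Y : TangentSpace J p) : TwoVectorAt J p :=
  LinearMap.mk₂ ℝ (fun α β => α X * β Y - α Y * β X)
    (fun _ _ _ => by simp only [add_apply]; ring)
    (fun _ _ _ => by simp only [smul_apply, smul_eq_mul]; ring)
    (fun _ _ _ => by simp only [add_apply]; ring)
    (fun _ _ _ => by simp only [smul_apply, smul_eq_mul]; ring)

variable (N) in
/-- Smooth 2-vectors (bivector fields) on `N`. Smoothness means that `Λ(df, dg)` is smooth for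
all smooth functions `f`, `g`; this says that the components of `Λ` in charts are smooth. -/
structure BivectorField where
  toFun : ∀ p : N, TwoVectorAt J p
  alternating : ∀ (p : N) (α : TangentSpace J p →L[ℝ] ℝ), toFun p α α = 0
  smooth : ∀ f g : N → ℝ, ContMDiff J 𝓘(ℝ, ℝ) ∞ f → ContMDiff J 𝓘(ℝ, ℝ) ∞ g →
    ContMDiff J 𝓘(ℝ, ℝ) ∞ (fun p => toFun p (mvfderiv J f p) (mvfderiv J g p))

variable {J}

/-- The function `Λ(df, dg)`. -/
def BivectorField.onFun (P : BivectorField J N) (f g : N → ℝ) : N → ℝ :=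
  fun p => P.toFun p (mvfderiv J f p) (mvfderiv J g p)

/-- The value `[P, Q]_SN(df, dg, dh)` of the Schouten-Nijenhuis bracket of two 2-vectors on exact
1-forms; these values determine the 3-vector `[P, Q]_SN`. The sign is that of the convention
`[X₁ ∧ ⋯ ∧ Xₖ, Y₁ ∧ ⋯ ∧ Yₗ] = (-1)^(k+1) ∑ (-1)^(i+j) [Xᵢ, Yⱼ] ∧ X₁ ∧ ⋯ X̂ᵢ ⋯ ∧ Xₖ ∧ Y₁ ∧ ⋯ Ŷⱼ ⋯ ∧ Yₗ`,
the one for which the Jacobi bracket of a Jacobi structure satisfies the Jacobi identity. -/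
def schoutenBivector (P Q : BivectorField J N) (f g h : N → ℝ) : N → ℝ :=
  P.onFun (Q.onFun f g) h + P.onFun (Q.onFun g h) f + P.onFun (Q.onFun h f) g
    + (Q.onFun (P.onFun f g) h + Q.onFun (P.onFun g h) f + Q.onFun (P.onFun h f) g)

variable [IsManifold J ∞ N]

/-- The function `X(f)`. -/
def applyField (X : Cₛ^∞⟮J; E, (TangentSpace J : N → Type _)⟯) (f : N → ℝ) : N → ℝ :=
  fun p => mvfderiv J f p (X p)

/-- The value `[X, P]_SN(df, dg) = (L_X P)(df, dg)` of the Schouten-Nijenhuis bracket of a vector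
field and a 2-vector on exact 1-forms; these values determine the 2-vector `[X, P]_SN`. -/
def schoutenField (X : Cₛ^∞⟮J; E, (TangentSpace J : N → Type _)⟯) (P : BivectorField J N)
    (f g : N → ℝ) : N → ℝ :=
  applyField X (P.onFun f g) - P.onFun (applyField X f) g - P.onFun f (applyField X g)

/-- The value `(X ∧ P)(df, dg, dh)` of the 3-vector `X ∧ P`. -/
def wedgeField (X : Cₛ^∞⟮J; E, (TangentSpace J : N → Type _)⟯) (P : BivectorField J N)
    (f g h : N → ℝ) : N → ℝ :=
  applyField X f * P.onFun g h + applyField X g * P.onFun h f + applyField X h * P.onFun f g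

variable (J N) in
/-- Jacobi structures `(Λ, E)`: `[Λ, Λ]_SN = 2 E ∧ Λ` and `[E, Λ]_SN = 0`. -/
structure JacobiStructure where
  bivector : BivectorField J N
  field : Cₛ^∞⟮J; E, (TangentSpace J : N → Type _)⟯
  schouten_bivector : ∀ f g h : N → ℝ, ContMDiff J 𝓘(ℝ, ℝ) ∞ f → ContMDiff J 𝓘(ℝ, ℝ) ∞ g →
    ContMDiff J 𝓘(ℝ, ℝ) ∞ h →
    schoutenBivector bivector bivector f g h = 2 • wedgeField field bivector f g h
  schouten_field : ∀ f g : N → ℝ, ContMDiff J 𝓘(ℝ, ℝ) ∞ f → ContMDiff J 𝓘(ℝ, ℝ) ∞ g →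
    schoutenField field bivector f g = 0

/-- The Jacobi bracket `{f, g} = Λ(df, dg) + f E(g) - g E(f)`. -/
def JacobiStructure.bracket (S : JacobiStructure J N) (f g : N → ℝ) : N → ℝ :=
  S.bivector.onFun f g + f * applyField S.field g - g * applyField S.field f

end JacobiStructures

/-! ### Lie algebroids and the dual bundle -/

section LieAlgebroids

variable (E : Type*) [NormedAddCommGroup E] [NormedSpace ℝ E]
  {M : Type*} [TopologicalSpace M] [ChartedSpace E M]
  (F : Type*) [NormedAddCommGroup F] [NormedSpace ℝ F]
  (A : M → Type*) [TopologicalSpace (TotalSpace F A)] [∀ x, AddCommGroup (A x)]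
  [∀ x, Module ℝ (A x)] [∀ x, TopologicalSpace (A x)] [FiberBundle F A] [VectorBundle ℝ F A]

/-- The space `Γ(A)` of smooth sections of `A → M`. -/
abbrev Sections : Type _ := Cₛ^∞⟮𝓘(ℝ, E); F, A⟯

/-- The space `Γ(A^*)` of smooth sections of the dual bundle. -/
abbrev DualSections : Type _ := Cₛ^∞⟮𝓘(ℝ, E); F →L[ℝ] ℝ, fun x : M => A x →L[ℝ] ℝ⟯

/-- The total space of the dual bundle `A^* → M`. -/
abbrev DualTotal : Type _ := TotalSpace (F →L[ℝ] ℝ) (fun x : M => A x →L[ℝ] ℝ)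

/-- The model with corners of the manifold `A^*`. -/
abbrev dualModel : ModelWithCorners ℝ (E × (F →L[ℝ] ℝ)) (ModelProd E (F →L[ℝ] ℝ)) :=
  𝓘(ℝ, E).prod 𝓘(ℝ, F →L[ℝ] ℝ)

variable {E F A}

/-- The section `f η` for a smooth function `f`. -/
def smulSection (f : M → ℝ) (hf : ContMDiff 𝓘(ℝ, E) 𝓘(ℝ, ℝ) ∞ f) (η : Sections E F A) :
    Sections E F A :=
  ⟨fun x => f x • η x, hf.smul_section η.contMDiff⟩

variable (E) in
/-- Linear functions on `A^*`: smooth functions that are linear on each fibre. -/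
def IsLinearFunction (h : DualTotal F A → ℝ) : Prop :=
  ContMDiff (dualModel E F) 𝓘(ℝ, ℝ) ∞ h ∧
    ∀ x : M, IsLinearMap ℝ (fun α : A x →L[ℝ] ℝ => h ⟨x, α⟩)

variable (E) in
/-- Basic functions on `A^*`: those of the form `f ∘ π^*` with `f` smooth on `M`. -/
def IsBasicFunction (h : DualTotal F A → ℝ) : Prop :=
  ∃ f : M → ℝ, ContMDiff 𝓘(ℝ, E) 𝓘(ℝ, ℝ) ∞ f ∧ ∀ p : DualTotal F A, h p = f p.proj

variable [IsManifold 𝓘(ℝ, E) ∞ M]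

variable (E F A) in
/-- Lie algebroid structures on `A → M`. The anchor is a smooth section of `Hom(A, TM)`. -/
structure LieAlgebroid where
  bracket : Sections E F A →ₗ[ℝ] Sections E F A →ₗ[ℝ] Sections E F A
  bracket_self : ∀ μ, bracket μ μ = 0
  jacobi : ∀ μ η ζ, bracket μ (bracket η ζ) + bracket η (bracket ζ μ)
    + bracket ζ (bracket μ η) = 0
  anchor : Cₛ^∞⟮𝓘(ℝ, E); F →L[ℝ] E, fun x : M => A x →L[ℝ] TangentSpace 𝓘(ℝ, E) x⟯
  anchor_bracket : ∀ (μ η : Sections E F A) (x : M), anchor x (bracket μ η x) =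
    VectorField.mlieBracket 𝓘(ℝ, E) (fun y => anchor y (μ y)) (fun y => anchor y (η y)) x
  leibniz : ∀ (f : M → ℝ) (hf : ContMDiff 𝓘(ℝ, E) 𝓘(ℝ, ℝ) ∞ f) (μ η : Sections E F A) (x : M),
    bracket μ (smulSection f hf η) x =
      f x • bracket μ η x + mvfderiv 𝓘(ℝ, E) f x (anchor x (μ x)) • η x

/-- `φ ∈ Γ(A^*)` is a 1-cocycle: `φ[μ, η] = ρ(μ)(φ(η)) - ρ(η)(φ(μ))`. -/
def LieAlgebroid.IsCocycle (L : LieAlgebroid E F A) (φ : DualSections E F A) : Prop :=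
  ∀ (μ η : Sections E F A) (x : M), φ x (L.bracket μ η x) =
    mvfderiv 𝓘(ℝ, E) (fun y => φ y (η y)) x (L.anchor x (μ x))
      - mvfderiv 𝓘(ℝ, E) (fun y => φ y (μ y)) x (L.anchor x (η x))

/-! ### The Jacobi structure on the dual bundle of a Lie algebroid with a 1-cocycle -/

variable (E) in
/-- The vertical tangent vector at `p = (x, α)` given by `β ∈ A_x^*`: the velocity at `t = 0` of
the curve `t ↦ (x, α + t β)`. -/
def verticalVector (p : DualTotal F A) (β : A p.proj →L[ℝ] ℝ) :
    TangentSpace (dualModel E F) p :=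
  mfderiv 𝓘(ℝ, ℝ) (dualModel E F)
    (fun t : ℝ => (⟨p.proj, p.snd + t • β⟩ : DualTotal F A)) 0 (1 : ℝ)

variable (E) in
/-- The Liouville vector field `Δ` of `A^*`. -/
def liouville (p : DualTotal F A) : TangentSpace (dualModel E F) p :=
  verticalVector E p p.snd

/-- The vertical lift `φ^v` of `φ ∈ Γ(A^*)`. -/
def verticalLift (φ : DualSections E F A) (p : DualTotal F A) : TangentSpace (dualModel E F) p :=
  verticalVector E p (φ p.proj)

variable [FiniteDimensional ℝ E] [FiniteDimensional ℝ F] [T2Space M]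
  [ContMDiffVectorBundle ∞ F A 𝓘(ℝ, E)]

variable (E F A) in
/-- Near each point `x`, the members of the local frame of `A` given by the trivialization at `x`
and a basis of the model fibre are restrictions of global sections. -/
theorem exists_section_eq_localFrame (x : M) (i : Fin (Module.finrank ℝ F)) :
    ∃ s : Sections E F A, ∀ᶠ y in 𝓝 x,
      s y = (trivializationAt F A x).localFrame (Module.finBasis ℝ F) i y := by
  obtain ⟨f, -, hf⟩ := (SmoothBumpFunction.nhds_basis_tsupport (I := 𝓘(ℝ, E)) x).mem_iff.1
    ((trivializationAt F A x).open_baseSet.mem_nhds (mem_baseSet_trivializationAt F A x))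
  refine ⟨⟨_, ContMDiffOn.smul_section_of_tsupport f.contMDiff.contMDiffOn
    (trivializationAt F A x).open_baseSet hf
    ((trivializationAt F A x).contMDiffOn_localFrame_baseSet ∞ (Module.finBasis ℝ F) i)⟩, ?_⟩
  filter_upwards [f.eventuallyEq_one] with y hy
  simp [hy]

variable (E F A) in
/-- Global sections `e₁, …, eₙ` of `A` which near `x` are the local frame given by the
trivialization at `x`. Brackets of local sections at `x` are computed with such extensions. -/
def frame (x : M) (i : Fin (Module.finrank ℝ F)) : Sections E F A :=
  (exists_section_eq_localFrame E F A x i).choose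

/-- The structure functions `c_{ij}^k(x)`: `[e_i, e_j] = ∑ₖ c_{ij}^k e_k`. -/
def LieAlgebroid.structureFunction (L : LieAlgebroid E F A) (x : M)
    (i j k : Fin (Module.finrank ℝ F)) : ℝ :=
  ((trivializationAt F A x).basisAt (Module.finBasis ℝ F)
    (mem_baseSet_trivializationAt F A x)).repr (L.bracket (frame E F A x i) (frame E F A x j) x) k

/-- The components `ρ_i^l(x)` of the anchor: `ρ(e_i) = ∑ₗ ρ_i^l ∂/∂x^l`, where `x^l` are the
coordinates of the chart at `x`. -/
def LieAlgebroid.anchorComponent (L : LieAlgebroid E F A) (x : M)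
    (i : Fin (Module.finrank ℝ F)) (l : Fin (Module.finrank ℝ E)) : ℝ :=
  (Module.finBasis ℝ E).repr (L.anchor x (frame E F A x i x)) l

variable (E) in
/-- The vector `∂/∂x^l` at `p ∈ A^*` of the fibred coordinates `(x^l, μ_j)` given by the chart
and the trivialization at `π^*(p)`. The tangent space of `A^*` at `p` is the model space
`E × F^*`, by means of the chart of `A^*` at `p`, which is built from these two. -/
def partialX (p : DualTotal F A) (l : Fin (Module.finrank ℝ E)) :
    TangentSpace (dualModel E F) p :=
  ((Module.finBasis ℝ E l, 0) : E × (F →L[ℝ] ℝ))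

variable (E) in
/-- The vector `∂/∂μ_i` at `p ∈ A^*` of the same fibred coordinates. -/
def partialMu (p : DualTotal F A) (i : Fin (Module.finrank ℝ F)) :
    TangentSpace (dualModel E F) p :=
  ((0, LinearMap.toContinuousLinearMap ((Module.finBasis ℝ F).coord i)) : E × (F →L[ℝ] ℝ))

/-- The 2-vector `Λ_{A^*}` at `p ∈ A^*`:
`∑_{i<j} ∑ₖ c_{ij}^k μ_k ∂/∂μ_i ∧ ∂/∂μ_j + ∑_{i,l} ρ_i^l ∂/∂μ_i ∧ ∂/∂x^l`, with
`μ_k(p) = p(e_k)`. -/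
def LieAlgebroid.linearPoisson (L : LieAlgebroid E F A) (p : DualTotal F A) :
    TwoVectorAt (dualModel E F) p :=
  (∑ i, ∑ j ∈ Finset.Ioi i, ∑ k,
      (L.structureFunction p.proj i j k * p.snd (frame E F A p.proj k p.proj)) •
        wedge (dualModel E F) (partialMu E p i) (partialMu E p j))
    + ∑ i, ∑ l, L.anchorComponent p.proj i l •
        wedge (dualModel E F) (partialMu E p i) (partialX E p l)

/-- The 2-vector `Λ_{(A^*, φ)} = Λ_{A^*} + Δ ∧ φ^v`. -/
def LieAlgebroid.dualBivector (L : LieAlgebroid E F A) (φ : DualSections E F A)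
    (p : DualTotal F A) : TwoVectorAt (dualModel E F) p :=
  L.linearPoisson p + wedge (dualModel E F) (liouville E p) (verticalLift φ p)

/-- The vector field `E_{(A^*, φ)} = -φ^v`. -/
def dualField (φ : DualSections E F A) (p : DualTotal F A) : TangentSpace (dualModel E F) p :=
  -verticalLift φ p

end LieAlgebroids

end

noncomputable section

/-! ### Calculus of Jacobi brackets -/

section JacobiCalculus

variable {E : Type*} [NormedAddCommGroup E] [NormedSpace ℝ E] {H : Type*} [TopologicalSpace H]
  {J : ModelWithCorners ℝ E H} {N : Type*} [TopologicalSpace N] [ChartedSpace H N]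

/-! Write `μ~` for the linear function of a section `μ` and `f` also for `f ∘ π^*`. Linear functions
are exactly the `μ~` (`exists_section_of_isLinearFunction`), so (C1) turns the Jacobi bracket into a
bracket on `Γ(A)`, and `jacobi_identity` makes it a Lie bracket. The rest comes from playing Leibniz
rules against the identity `(fμ)~ = f μ~`.

Since `{μ~, 1} = -E(μ~)`, (C2) says that `E` sends linear functions to basic ones. Applied to `fμ`,
this makes `E(f) μ~` basic for every `μ`, which in positive rank forces `E(f) = 0`
(`applyField_comp_proj`). Then `{μ~, f η~} - f {μ~, η~} = Λ(dμ~, df) η~` is linear for every `η`, so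
`Λ(dμ~, df)` is basic (`onFun_sectionFunction_comp_proj_eq`). Replacing `μ` by a multiple of it
gives `Λ(df, dg) = 0` (`onFun_comp_proj_comp_proj`). Hence `ρ(μ)f = Λ(dμ~, df)` and `φ(μ) = -E(μ~)`
define an anchor and a section of `A^*`; both are read off along the zero section.

Now `{μ~, f}` is the basic function `ρ(μ)f + f φ(μ)`, and the Jacobi identity for `μ~`, `η~`, `f`
says that `μ ↦ ρ(μ) + φ(μ)` takes brackets to commutators (`twistedDeriv_sectionBracket`). The case
`f = 1` is the cocycle condition; removing it from the general case shows that `ρ` preserves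
brackets.

Finally, differentials of basic and linear functions span every cotangent space of `A^*`
(`exists_covector_eq`), so the formulas for `Λ` and `E` need checking only on those. -/

theorem ContMDiff.mdifferentiableAt_of_smooth {f : N → ℝ} (hf : ContMDiff J 𝓘(ℝ, ℝ) ∞ f) (p : N) :
    MDifferentiableAt J 𝓘(ℝ, ℝ) f p :=
  (hf p).mdifferentiableAt (by simp)

namespace BivectorField

variable (P : BivectorField J N) {f g h : N → ℝ}

theorem toFun_swap (p : N) (α β : TangentSpace J p →L[ℝ] ℝ) :
    P.toFun p α β = -P.toFun p β α := by
  have h := P.alternating p (α + β)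
  simp only [map_add, LinearMap.add_apply, P.alternating] at h
  linarith

theorem onFun_swap (f g : N → ℝ) (p : N) : P.onFun f g p = -P.onFun g f p :=
  P.toFun_swap p _ _

theorem onFun_self (f : N → ℝ) (p : N) : P.onFun f f p = 0 := P.alternating p _

theorem contMDiff_onFun (hf : ContMDiff J 𝓘(ℝ, ℝ) ∞ f) (hg : ContMDiff J 𝓘(ℝ, ℝ) ∞ g) :
    ContMDiff J 𝓘(ℝ, ℝ) ∞ (P.onFun f g) := P.smooth f g hf hg

theorem onFun_add_right (hg : ContMDiff J 𝓘(ℝ, ℝ) ∞ g) (hh : ContMDiff J 𝓘(ℝ, ℝ) ∞ h) (p : N) :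
    P.onFun f (g + h) p = P.onFun f g p + P.onFun f h p := by
  simp [onFun, mvfderiv_add (hg.mdifferentiableAt_of_smooth p) (hh.mdifferentiableAt_of_smooth p)]

theorem onFun_sub_right (hg : ContMDiff J 𝓘(ℝ, ℝ) ∞ g) (hh : ContMDiff J 𝓘(ℝ, ℝ) ∞ h) (p : N) :
    P.onFun f (g - h) p = P.onFun f g p - P.onFun f h p := by
  simp [onFun, mvfderiv_sub (hg.mdifferentiableAt_of_smooth p) (hh.mdifferentiableAt_of_smooth p)]

theorem onFun_mul_right (hg : ContMDiff J 𝓘(ℝ, ℝ) ∞ g) (hh : ContMDiff J 𝓘(ℝ, ℝ) ∞ h) (p : N) :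
    P.onFun f (g * h) p = g p * P.onFun f h p + h p * P.onFun f g p := by
  simp [onFun, mvfderiv_mul (hg.mdifferentiableAt_of_smooth p) (hh.mdifferentiableAt_of_smooth p)]

theorem onFun_mul_left (hg : ContMDiff J 𝓘(ℝ, ℝ) ∞ g) (hh : ContMDiff J 𝓘(ℝ, ℝ) ∞ h) (p : N) :
    P.onFun (g * h) f p = g p * P.onFun h f p + h p * P.onFun g f p := by
  rw [P.onFun_swap, P.onFun_mul_right hg hh, P.onFun_swap f h, P.onFun_swap f g]; ring

end BivectorField

variable [IsManifold J ∞ N]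

section Field

variable (X : Cₛ^∞⟮J; E, (TangentSpace J : N → Type _)⟯) {f g : N → ℝ}

/-- `X(f)` is the fibre component of the tangent map of `f` composed with the section `X`. -/
theorem contMDiff_applyField (hf : ContMDiff J 𝓘(ℝ, ℝ) ∞ f) :
    ContMDiff J 𝓘(ℝ, ℝ) ∞ (applyField X f) := by
  have h := (contMDiff_snd_tangentBundle_modelSpace ℝ 𝓘(ℝ, ℝ)).comp
    ((hf.contMDiff_tangentMap (m := ∞) (by simp)).comp X.contMDiff)
  exact h

theorem applyField_add (hf : ContMDiff J 𝓘(ℝ, ℝ) ∞ f) (hg : ContMDiff J 𝓘(ℝ, ℝ) ∞ g) (p : N) :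
    applyField X (f + g) p = applyField X f p + applyField X g p := by
  simp [applyField,
    mvfderiv_add (hf.mdifferentiableAt_of_smooth p) (hg.mdifferentiableAt_of_smooth p)]

theorem applyField_sub (hf : ContMDiff J 𝓘(ℝ, ℝ) ∞ f) (hg : ContMDiff J 𝓘(ℝ, ℝ) ∞ g) (p : N) :
    applyField X (f - g) p = applyField X f p - applyField X g p := by
  simp [applyField,
    mvfderiv_sub (hf.mdifferentiableAt_of_smooth p) (hg.mdifferentiableAt_of_smooth p)]

theorem applyField_mul (hf : ContMDiff J 𝓘(ℝ, ℝ) ∞ f) (hg : ContMDiff J 𝓘(ℝ, ℝ) ∞ g) (p : N) :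
    applyField X (f * g) p = f p * applyField X g p + g p * applyField X f p := by
  simp [applyField,
    mvfderiv_mul (hf.mdifferentiableAt_of_smooth p) (hg.mdifferentiableAt_of_smooth p)]

end Field

namespace JacobiStructure

variable (S : JacobiStructure J N) {f g h : N → ℝ}

theorem bracket_apply (f g : N → ℝ) (p : N) :
    S.bracket f g p = S.bivector.onFun f g p + f p * applyField S.field g p
      - g p * applyField S.field f p := rfl

theorem bracket_bracket (hg : ContMDiff J 𝓘(ℝ, ℝ) ∞ g)
    (hh : ContMDiff J 𝓘(ℝ, ℝ) ∞ h) (p : N) :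
    S.bracket f (S.bracket g h) p =
      S.bivector.onFun f (S.bivector.onFun g h) p
      + g p * S.bivector.onFun f (applyField S.field h) p
      + applyField S.field h p * S.bivector.onFun f g p
      - h p * S.bivector.onFun f (applyField S.field g) p
      - applyField S.field g p * S.bivector.onFun f h p
      + f p * (applyField S.field (S.bivector.onFun g h) p
        + g p * applyField S.field (applyField S.field h) p
        - h p * applyField S.field (applyField S.field g) p)
      - S.bracket g h p * applyField S.field f p := by
  have hP := S.bivector.contMDiff_onFun hg hh
  have hEg := contMDiff_applyField S.field hg
  have hEh := contMDiff_applyField S.field hh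
  have h1 : ContMDiff J 𝓘(ℝ, ℝ) ∞ (g * applyField S.field h) := hg.mul hEh
  have h2 : ContMDiff J 𝓘(ℝ, ℝ) ∞ (h * applyField S.field g) := hh.mul hEg
  have h3 : ContMDiff J 𝓘(ℝ, ℝ) ∞ (S.bivector.onFun g h + g * applyField S.field h) := hP.add h1
  rw [S.bracket_apply f]
  have e : S.bracket g h = S.bivector.onFun g h + g * applyField S.field h
    - h * applyField S.field g := rfl
  rw [show S.bivector.onFun f (S.bracket g h) p = _ from congrArg (S.bivector.onFun f · p) e,
    show applyField S.field (S.bracket g h) p = _ from congrArg (applyField S.field · p) e]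
  rw [S.bivector.onFun_sub_right h3 h2, S.bivector.onFun_add_right hP h1,
    S.bivector.onFun_mul_right hg hEh, S.bivector.onFun_mul_right hh hEg,
    applyField_sub _ h3 h2, applyField_add _ hP h1, applyField_mul _ hg hEh,
    applyField_mul _ hh hEg]
  ring

/-- The Jacobi bracket of a Jacobi structure satisfies the Jacobi identity. -/
theorem jacobi_identity (hf : ContMDiff J 𝓘(ℝ, ℝ) ∞ f) (hg : ContMDiff J 𝓘(ℝ, ℝ) ∞ g)
    (hh : ContMDiff J 𝓘(ℝ, ℝ) ∞ h) (p : N) :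
    S.bracket f (S.bracket g h) p + S.bracket g (S.bracket h f) p
      + S.bracket h (S.bracket f g) p = 0 := by
  have key := congrFun (S.schouten_bivector f g h hf hg hh) p
  have k1 := congrFun (S.schouten_field f g hf hg) p
  have k2 := congrFun (S.schouten_field g h hg hh) p
  have k3 := congrFun (S.schouten_field h f hh hf) p
  rw [S.bracket_bracket hg hh, S.bracket_bracket hh hf, S.bracket_bracket hf hg]
  simp only [schoutenBivector, wedgeField, schoutenField, Pi.add_apply, Pi.mul_apply, Pi.sub_apply,
    Pi.smul_apply, Pi.zero_apply, nsmul_eq_mul, Nat.cast_ofNat] at key k1 k2 k3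
  have s := S.bivector.onFun_swap
  rw [s f (S.bivector.onFun g h), s g (S.bivector.onFun h f), s h (S.bivector.onFun f g)]
  rw [s (applyField S.field f) g] at k1
  rw [s (applyField S.field g) h] at k2
  rw [s (applyField S.field h) f] at k3
  rw [S.bracket_apply, S.bracket_apply, S.bracket_apply, s f h, s g f, s h g]
  -- With both arguments equal to `Λ`, the Schouten bracket counts every cyclic term twice, hence
  -- the factor 1/2. Each identity `L_E Λ = 0` is weighted by the function it does not involve.
  linear_combination (-1 / 2) * key + h p * k1 + f p * k2 + g p * k3

end JacobiStructure

end JacobiCalculus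

/-! ### Global extensions of local functions -/

section Extension

variable {E : Type*} [NormedAddCommGroup E] [NormedSpace ℝ E] [FiniteDimensional ℝ E]
  {M : Type*} [TopologicalSpace M] [T2Space M] [ChartedSpace E M] [IsManifold 𝓘(ℝ, E) ∞ M]

/-- A smooth function defined near `x` agrees near `x` with a global smooth function. -/
theorem exists_contMDiff_eventuallyEq {f : M → ℝ} {x : M} {U : Set M} (hU : IsOpen U)
    (hx : x ∈ U) (hf : ContMDiffOn 𝓘(ℝ, E) 𝓘(ℝ, ℝ) ∞ f U) :
    ∃ g : M → ℝ, ContMDiff 𝓘(ℝ, E) 𝓘(ℝ, ℝ) ∞ g ∧ g =ᶠ[𝓝 x] f := by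
  obtain ⟨ψ, -, hψ⟩ := (SmoothBumpFunction.nhds_basis_tsupport (I := 𝓘(ℝ, E)) x).mem_iff.1
    (hU.mem_nhds hx)
  refine ⟨fun y => ψ y • f y, ?_, ?_⟩
  · refine contMDiff_of_tsupport fun y hy => ?_
    have hy' : y ∈ U := hψ (tsupport_smul_subset_left _ _ hy)
    exact ψ.contMDiff.contMDiffAt.smul ((hf y hy').contMDiffAt (hU.mem_nhds hy'))
  · filter_upwards [ψ.eventuallyEq_one] with y hy
    simp [hy]

variable (E) in
/-- Every covector at `x` is the differential of a global smooth function, which near `x` is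
linear in the chart at `x`. -/
theorem exists_contMDiff_eventuallyEq_chart (x : M) (ℓ : E →L[ℝ] ℝ) :
    ∃ g : M → ℝ, ContMDiff 𝓘(ℝ, E) 𝓘(ℝ, ℝ) ∞ g ∧ g =ᶠ[𝓝 x] fun y => ℓ (extChartAt 𝓘(ℝ, E) x y) :=
  exists_contMDiff_eventuallyEq (isOpen_extChartAt_source (I := 𝓘(ℝ, E)) x)
    (mem_extChartAt_source x)
    (ℓ.contMDiff.comp_contMDiffOn (contMDiffOn_extChartAt.mono (by simp)))

end Extension

/-! ### Vector fields as derivations -/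

section VectorFields

variable {E : Type*} [NormedAddCommGroup E] [NormedSpace ℝ E]
  {M : Type*} [TopologicalSpace M] [ChartedSpace E M] [IsManifold 𝓘(ℝ, E) ∞ M]

/-- The tangent trivialization at `x` is the derivative of the chart at `x`, also at nearby points
`y`. Letting `y` vary is what allows smoothness of a vector field to be tested on functions. -/
theorem mvfderiv_eq_trivializationAt {g : M → ℝ} {x y : M} (ℓ : E →L[ℝ] ℝ)
    (hg : g =ᶠ[𝓝 y] fun z => ℓ (extChartAt 𝓘(ℝ, E) x z)) (hy : y ∈ (chartAt E x).source)
    (v : TangentSpace 𝓘(ℝ, E) y) :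
    mvfderiv 𝓘(ℝ, E) g y v =
      ℓ (trivializationAt E (TangentSpace 𝓘(ℝ, E) : M → Type _) x ⟨y, v⟩).2 := by
  have h1 : mvfderiv 𝓘(ℝ, E) g y v =
      mfderiv 𝓘(ℝ, E) 𝓘(ℝ, ℝ) (ℓ ∘ extChartAt 𝓘(ℝ, E) x) y v := by
    have := hg.mfderiv_eq (I := 𝓘(ℝ, E)) (I' := 𝓘(ℝ, ℝ))
    rw [mvfderiv]
    change mfderiv 𝓘(ℝ, E) 𝓘(ℝ, ℝ) g y v = _
    rw [this]; rfl
  have : IsManifold 𝓘(ℝ, E) 1 M := .of_le (n := ∞) (by simp)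
  rw [h1, mfderiv_comp y ℓ.mdifferentiableAt (mdifferentiableAt_extChartAt hy),
    ℓ.mfderiv_eq]
  have h2 := TangentBundle.continuousLinearMapAt_trivializationAt (I := 𝓘(ℝ, E)) hy
  have hy' : y ∈ (trivializationAt E (TangentSpace 𝓘(ℝ, E) : M → Type _) x).baseSet := hy
  have h3 : (trivializationAt E (TangentSpace 𝓘(ℝ, E) : M → Type _) x ⟨y, v⟩).2 =
    (trivializationAt E (TangentSpace 𝓘(ℝ, E) : M → Type _) x).continuousLinearMapAt ℝ y v := by
    rw [Trivialization.continuousLinearMapAt_apply, Trivialization.coe_linearMapAt_of_mem _ hy']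
  rw [h3, h2]
  rfl

theorem mvfderiv_eq_of_eventuallyEq_chart {g : M → ℝ} {x : M} (ℓ : E →L[ℝ] ℝ)
    (hg : g =ᶠ[𝓝 x] fun z => ℓ (extChartAt 𝓘(ℝ, E) x z)) : mvfderiv 𝓘(ℝ, E) g x = ℓ := by
  ext v
  rw [mvfderiv_eq_trivializationAt ℓ hg (mem_chart_source E x),
    TangentBundle.trivializationAt_apply]
  exact congrArg ℓ ((tangentBundleCore 𝓘(ℝ, E) M).coordChange_self (achart E x) x
    (mem_chart_source E x) v)

variable [FiniteDimensional ℝ E] [T2Space M]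

/-- A tangent vector is determined by the derivatives of smooth functions along it. -/
theorem tangentVector_ext {x : M} {v w : TangentSpace 𝓘(ℝ, E) x}
    (h : ∀ f : M → ℝ, ContMDiff 𝓘(ℝ, E) 𝓘(ℝ, ℝ) ∞ f →
      mvfderiv 𝓘(ℝ, E) f x v = mvfderiv 𝓘(ℝ, E) f x w) : v = w := by
  refine (Module.finBasis ℝ E).ext_elem fun i => ?_
  obtain ⟨g, hg, hgx⟩ := exists_contMDiff_eventuallyEq_chart E x
    (LinearMap.toContinuousLinearMap ((Module.finBasis ℝ E).coord i))
  have := h g hg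
  rw [mvfderiv_eq_of_eventuallyEq_chart _ hgx] at this
  exact this

/-- A vector field along which the derivatives of smooth functions are smooth is smooth. -/
theorem contMDiff_vectorField_of_forall {X : ∀ x : M, TangentSpace 𝓘(ℝ, E) x}
    (h : ∀ f : M → ℝ, ContMDiff 𝓘(ℝ, E) 𝓘(ℝ, ℝ) ∞ f →
      ContMDiff 𝓘(ℝ, E) 𝓘(ℝ, ℝ) ∞ (fun x => mvfderiv 𝓘(ℝ, E) f x (X x))) :
    ContMDiff 𝓘(ℝ, E) (𝓘(ℝ, E).prod 𝓘(ℝ, E)) ∞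
      (fun x => TotalSpace.mk' E x (X x) : M → TangentBundle 𝓘(ℝ, E) M) := by
  intro x
  refine (contMDiffAt_section x).2 ?_
  set b := Module.finBasis ℝ E
  have key : ∀ i, ContMDiffAt 𝓘(ℝ, E) 𝓘(ℝ, ℝ) ∞ (fun y => b.repr
      (trivializationAt E (TangentSpace 𝓘(ℝ, E) : M → Type _) x ⟨y, X y⟩).2 i) x := by
    intro i
    obtain ⟨g, hg, hgx⟩ := exists_contMDiff_eventuallyEq_chart E x
      (LinearMap.toContinuousLinearMap (b.coord i))
    refine (h g hg x).congr_of_eventuallyEq ?_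
    filter_upwards [hgx.eventuallyEq_nhds, (chartAt E x).open_source.mem_nhds
      (mem_chart_source E x)] with y hy hy'
    rw [mvfderiv_eq_trivializationAt _ hy hy']
    rfl
  have : (fun y => (trivializationAt E (TangentSpace 𝓘(ℝ, E) : M → Type _) x ⟨y, X y⟩).2) =
      fun y => ∑ i, b.repr
        (trivializationAt E (TangentSpace 𝓘(ℝ, E) : M → Type _) x ⟨y, X y⟩).2 i • b i := by
    ext y; rw [b.sum_repr]
  rw [this]
  exact contMDiffAt_finsetSum fun i _ => (key i).smul contMDiffAt_const

/-- The Lie bracket of vector fields acts on functions as the commutator. -/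
theorem mvfderiv_mlieBracket (U V : Cₛ^∞⟮𝓘(ℝ, E); E, (TangentSpace 𝓘(ℝ, E) : M → Type _)⟯)
    {f : M → ℝ} (hf : ContMDiff 𝓘(ℝ, E) 𝓘(ℝ, ℝ) ∞ f) (x : M) :
    mvfderiv 𝓘(ℝ, E) f x (VectorField.mlieBracket 𝓘(ℝ, E) U V x) =
      mvfderiv 𝓘(ℝ, E) (applyField V f) x (U x) - mvfderiv 𝓘(ℝ, E) (applyField U f) x (V x) := by
  have hM (n : ℕ) : IsManifold 𝓘(ℝ, E) n M := .of_le (n := ∞) (by exact_mod_cast le_top)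
  have hM1 : IsManifold 𝓘(ℝ, E) 1 M := hM 1
  have hM2 : IsManifold 𝓘(ℝ, E) 2 M := hM 2
  have hM3 : IsManifold 𝓘(ℝ, E) (minSmoothness ℝ 3) M := by simpa using hM 3
  have hM4 : IsManifold 𝓘(ℝ, E) (minSmoothness ℝ 2) M := by simpa using hM 2
  have hM5 : IsManifold 𝓘(ℝ, E) ((⊤ : ℕ∞) + 1 : WithTop ℕ∞) M := by simpa
  -- The argument needs a field `W` with `W x ≠ 0`, which exists only in positive dimension.
  rcases subsingleton_or_nontrivial E with hE | hE
  · have (v : TangentSpace 𝓘(ℝ, E) x) : v = 0 := hE.elim (α := E) v 0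
    simp [this (U x), this (V x), this (VectorField.mlieBracket 𝓘(ℝ, E) U V x)]
  · obtain ⟨W, hW⟩ := exists_section_eq_localFrame E E (TangentSpace 𝓘(ℝ, E) : M → Type _) x
      ⟨0, Module.finrank_pos⟩
    have hW0 : W x ≠ 0 := by
      rw [hW.self_of_nhds, Trivialization.localFrame_apply_of_mem_baseSet _ _
        (mem_baseSet_trivializationAt E _ x)]
      exact Module.Basis.ne_zero _ _
    have hC (Z : Cₛ^∞⟮𝓘(ℝ, E); E, (TangentSpace 𝓘(ℝ, E) : M → Type _)⟯) (y : M) :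
        ContMDiffAt 𝓘(ℝ, E) (𝓘(ℝ, E).prod 𝓘(ℝ, E)) (minSmoothness ℝ 2)
        (fun x => TotalSpace.mk' E x (Z x) : M → TangentBundle 𝓘(ℝ, E) M) y := by
      have : minSmoothness ℝ (2 : WithTop ℕ∞) = 2 := by simp
      rw [this]
      exact (Z.contMDiff y).of_le ENat.LEInfty.out
    have hB (Y Z : Cₛ^∞⟮𝓘(ℝ, E); E, (TangentSpace 𝓘(ℝ, E) : M → Type _)⟯) :
        ContMDiff 𝓘(ℝ, E) (𝓘(ℝ, E).prod 𝓘(ℝ, E)) ∞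
        (fun x => TotalSpace.mk' E x (VectorField.mlieBracket 𝓘(ℝ, E) Y Z x) :
          M → TangentBundle 𝓘(ℝ, E) M) := fun y =>
      ContMDiffAt.mlieBracket_vectorField (m := ⊤) (n := ⊤) (Y.contMDiff y) (Z.contMDiff y)
        (by simp)
    have hd (Z : Cₛ^∞⟮𝓘(ℝ, E); E, (TangentSpace 𝓘(ℝ, E) : M → Type _)⟯) (y : M) :=
      (Z.contMDiff y).mdifferentiableAt (by simp)
    have hfd (y : M) := hf.mdifferentiableAt_of_smooth y
    let fW : Cₛ^∞⟮𝓘(ℝ, E); E, (TangentSpace 𝓘(ℝ, E) : M → Type _)⟯ :=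
      ⟨fun y => f y • W y, hf.smul_section W.contMDiff⟩
    have e1 (Z : Cₛ^∞⟮𝓘(ℝ, E); E, (TangentSpace 𝓘(ℝ, E) : M → Type _)⟯) :
        VectorField.mlieBracket 𝓘(ℝ, E) Z fW =
          (applyField Z f • W) + f • VectorField.mlieBracket 𝓘(ℝ, E) Z W := by
      ext y
      exact VectorField.mlieBracket_smul_right (hfd y) (hd W y)
    have e2 (Y Z : Cₛ^∞⟮𝓘(ℝ, E); E, (TangentSpace 𝓘(ℝ, E) : M → Type _)⟯) :
        VectorField.mlieBracket 𝓘(ℝ, E) Y (VectorField.mlieBracket 𝓘(ℝ, E) Z fW) x =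
          mvfderiv 𝓘(ℝ, E) (applyField Z f) x (Y x) • W x
          + applyField Z f x • VectorField.mlieBracket 𝓘(ℝ, E) Y W x
          + (applyField Y f x • VectorField.mlieBracket 𝓘(ℝ, E) Z W x
          + f x • VectorField.mlieBracket 𝓘(ℝ, E) Y (VectorField.mlieBracket 𝓘(ℝ, E) Z W) x) := by
      have h1 := (contMDiff_applyField Z hf).mdifferentiableAt_of_smooth x
      have h2 := (hB Z W x).mdifferentiableAt (by simp)
      rw [e1, VectorField.mlieBracket_add_right, VectorField.mlieBracket_smul_right h1 (hd W x),
        VectorField.mlieBracket_smul_right (hfd x) h2]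
      · rfl
      · exact (((contMDiff_applyField Z hf).smul_section W.contMDiff) x).mdifferentiableAt (by simp)
      · exact ((hf.smul_section (hB Z W)) x).mdifferentiableAt (by simp)
    -- The Jacobi identities for `(U, V, W)` and `(U, V, fW)` are compared. The terms where `f` is
    -- not differentiated cancel by the first, the terms with one derivative on `f` are symmetric in
    -- `U` and `V`, and what remains is the claim multiplied by `W x`.
    have j1 := VectorField.leibniz_identity_mlieBracket_apply (hC U x) (hC V x) (hC W x)
    have j2 := VectorField.leibniz_identity_mlieBracket_apply (hC U x) (hC V x) (hC fW x)
    have e3 : VectorField.mlieBracket 𝓘(ℝ, E) (VectorField.mlieBracket 𝓘(ℝ, E) U V) fW x =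
        mvfderiv 𝓘(ℝ, E) f x (VectorField.mlieBracket 𝓘(ℝ, E) U V x) • W x +
        f x • VectorField.mlieBracket 𝓘(ℝ, E) (VectorField.mlieBracket 𝓘(ℝ, E) U V) W x :=
      VectorField.mlieBracket_smul_right (hfd x) (hd W x)
    rw [e2, e2, e3, j1] at j2
    refine smul_left_injective ℝ hW0 ?_
    simp only [sub_smul]
    linear_combination (norm := module) (-1 : ℝ) • j2

end VectorFields

/-! ### Differentials of basic and linear functions on the dual bundle -/

section Charts

variable {E : Type*} [NormedAddCommGroup E] [NormedSpace ℝ E] {H : Type*} [TopologicalSpace H]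
  {J : ModelWithCorners ℝ E H} {N : Type*} [TopologicalSpace N] [ChartedSpace H N]
  [IsManifold J ∞ N]

/-- The tangent space at `p` is the model space, identified by the preferred chart at `p`, whose
derivative at its own centre is the identity. -/
theorem mvfderiv_eq_fderiv_of_eventuallyEq {g : N → ℝ} {p : N} {Ψ : E → ℝ}
    (hΨ : DifferentiableAt ℝ Ψ (extChartAt J p p)) (hg : g =ᶠ[𝓝 p] Ψ ∘ extChartAt J p) :
    mvfderiv J g p = fderiv ℝ Ψ (extChartAt J p p) := by
  have : IsManifold J 1 N := .of_le (n := ∞) (by simp)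
  ext v
  change mfderiv J 𝓘(ℝ, ℝ) g p v = _
  rw [hg.mfderiv_eq, mfderiv_comp p hΨ.mdifferentiableAt
    (mdifferentiableAt_extChartAt (mem_chart_source H p)), mfderiv_extChartAt_self, mfderiv_eq_fderiv]
  rfl

end Charts

/-! ### The dual bundle in its fibred charts. -/

section DualBundle

variable {E : Type*} [NormedAddCommGroup E] [NormedSpace ℝ E]
  {M : Type*} [TopologicalSpace M] [ChartedSpace E M]
  {F : Type*} [NormedAddCommGroup F] [NormedSpace ℝ F]
  {A : M → Type*} [TopologicalSpace (TotalSpace F A)] [∀ x, AddCommGroup (A x)]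
  [∀ x, Module ℝ (A x)] [∀ x, TopologicalSpace (A x)] [FiberBundle F A] [VectorBundle ℝ F A]

/-- The trivialization at `x`, evaluated on the fibre over `x`. -/
abbrev fiberCoord (x : M) : A x →L[ℝ] F :=
  (trivializationAt F A x).continuousLinearMapAt ℝ x

/-- The trivialization of `A^*` is contragredient to that of `A`, so the pairing is the same in
coordinates. -/
theorem trivializationAt_dual_snd {x y : M} (hy : y ∈ (trivializationAt F A x).baseSet)
    (α : A y →L[ℝ] ℝ) (a : A y) :
    (trivializationAt (F →L[ℝ] ℝ) (fun x : M => A x →L[ℝ] ℝ) x ⟨y, α⟩).2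
      (trivializationAt F A x ⟨y, a⟩).2 = α a := by
  rw [hom_trivializationAt_apply]
  rw [ContinuousLinearMap.inCoordinates_eq hy (by simp)]
  simp [hy]

theorem fiberCoord_apply (x : M) (a : A x) :
    fiberCoord x a = (trivializationAt F A x ⟨x, a⟩).2 := by
  rw [fiberCoord, Trivialization.continuousLinearMapAt_apply,
    Trivialization.coe_linearMapAt_of_mem _ (mem_baseSet_trivializationAt F A x)]

theorem fiberCoord_injective (x : M) : Function.Injective (fiberCoord x : A x →L[ℝ] F) := by
  intro a b h
  refine ((trivializationAt F A x).continuousLinearEquivAt ℝ x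
    (mem_baseSet_trivializationAt F A x)).injective ?_
  simpa [fiberCoord_apply] using h

theorem dual_ext {x : M} [FiniteDimensional ℝ F] {a b : A x}
    (h : ∀ α : A x →L[ℝ] ℝ, α a = α b) : a = b := by
  refine fiberCoord_injective (F := F) x ?_
  refine (Module.finBasis ℝ F).ext_elem fun i => ?_
  exact h ((LinearMap.toContinuousLinearMap ((Module.finBasis ℝ F).coord i)).comp (fiberCoord x))

theorem contMDiff_fiber_line (x : M) (α β : A x →L[ℝ] ℝ) :
    ContMDiff 𝓘(ℝ, ℝ) (dualModel E F) ∞ (fun t : ℝ => (⟨x, α + t • β⟩ : DualTotal F A)) := by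
  intro t
  refine contMDiffAt_totalSpace.2 ⟨contMDiffAt_const, ?_⟩
  have hx := mem_baseSet_trivializationAt (F →L[ℝ] ℝ) (fun x : M => A x →L[ℝ] ℝ) x
  have e (s : ℝ) : (trivializationAt (F →L[ℝ] ℝ) (fun x : M => A x →L[ℝ] ℝ) x
      ⟨x, α + s • β⟩).2 = (trivializationAt (F →L[ℝ] ℝ) (fun x : M => A x →L[ℝ] ℝ) x ⟨x, α⟩).2
        + s • (trivializationAt (F →L[ℝ] ℝ) (fun x : M => A x →L[ℝ] ℝ) x ⟨x, β⟩).2 := by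
    have := (trivializationAt (F →L[ℝ] ℝ) (fun x : M => A x →L[ℝ] ℝ) x).linear ℝ hx
    rw [this.1, this.2]
  simp only [e]
  exact contMDiffAt_const.add (contMDiffAt_id.smul contMDiffAt_const)

/-- The function `α ↦ α (μ x)` on `A^*`. -/
def sectionFunction (μ : Sections E F A) : DualTotal F A → ℝ := fun p => p.snd (μ p.proj)

theorem section_ext [FiniteDimensional ℝ F] {μ η : Sections E F A}
    (h : ∀ p, sectionFunction μ p = sectionFunction η p) : μ = η :=
  ContMDiffSection.ext fun x => dual_ext (F := F) fun α => h ⟨x, α⟩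

/-- Over the total space of `A^*`, the identity map is a smooth tautological family of functionals,
and it is paired with the pullback of `μ`. -/
theorem contMDiff_sectionFunction (μ : Sections E F A) :
    ContMDiff (dualModel E F) 𝓘(ℝ, ℝ) ∞ (sectionFunction μ) := by
  have h := ContMDiff.clm_bundle_apply (IB := 𝓘(ℝ, E)) (IM := dualModel E F) (F₁ := F) (F₂ := ℝ)
    (E₁ := A) (E₂ := Bundle.Trivial M ℝ) (n := ∞) (b := fun p : DualTotal F A => p.proj)
    (ϕ := fun p => p.snd) (v := fun p => μ p.proj) contMDiff_id
    (μ.contMDiff.comp (contMDiff_proj _))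
  intro p
  exact (contMDiffAt_totalSpace.1 (h p)).2

theorem isLinearFunction_sectionFunction (μ : Sections E F A) :
    IsLinearFunction E (sectionFunction μ) :=
  ⟨contMDiff_sectionFunction μ, fun _ => ⟨fun _ _ => rfl, fun _ _ => rfl⟩⟩

theorem extChartAt_dual_apply (p q : DualTotal F A) :
    extChartAt (dualModel E F) p q = (extChartAt 𝓘(ℝ, E) p.proj q.proj,
      (trivializationAt (F →L[ℝ] ℝ) (fun x : M => A x →L[ℝ] ℝ) p.proj q).2) := by
  rw [FiberBundle.extChartAt]
  rfl

theorem eventually_proj_mem {p : DualTotal F A} {s : Set M} (hs : s ∈ 𝓝 p.proj) :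
    ∀ᶠ q : DualTotal F A in 𝓝 p, q.proj ∈ s :=
  (FiberBundle.continuous_proj (F →L[ℝ] ℝ) (fun x : M => A x →L[ℝ] ℝ)).continuousAt hs

/-- A section of `A`, read in the trivialization at `x`. -/
def sectionCoord (μ : Sections E F A) (x : M) : M → F := fun y => (trivializationAt F A x ⟨y, μ y⟩).2

theorem mvfderiv_verticalVector {g : DualTotal F A → ℝ}
    (hg : ContMDiff (dualModel E F) 𝓘(ℝ, ℝ) ∞ g) (p : DualTotal F A) (β : A p.proj →L[ℝ] ℝ) :
    mvfderiv (dualModel E F) g p (verticalVector E p β) =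
      deriv (fun t : ℝ => g ⟨p.proj, p.snd + t • β⟩) 0 := by
  have h0 : (⟨p.proj, p.snd + (0 : ℝ) • β⟩ : DualTotal F A) = p := by simp
  have h := mvfderiv_comp_apply_of_eq (I := dualModel E F) (I' := 𝓘(ℝ, ℝ)) (g := g)
    (f := fun t : ℝ => (⟨p.proj, p.snd + t • β⟩ : DualTotal F A)) (y := p) 0
    (hg.mdifferentiableAt_of_smooth p)
    ((contMDiff_fiber_line p.proj p.snd β 0).mdifferentiableAt (by simp)) h0 (1 : ℝ)
  refine Eq.trans h.symm ?_
  change mfderiv 𝓘(ℝ, ℝ) 𝓘(ℝ, ℝ) _ 0 (1 : ℝ) = _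
  rw [mfderiv_eq_fderiv]
  rfl

theorem mvfderiv_comp_proj_verticalVector {f : M → ℝ} (hf : ContMDiff 𝓘(ℝ, E) 𝓘(ℝ, ℝ) ∞ f)
    (p : DualTotal F A) (β : A p.proj →L[ℝ] ℝ) :
    mvfderiv (dualModel E F) (f ∘ TotalSpace.proj) p (verticalVector E p β) = 0 := by
  rw [mvfderiv_verticalVector (hf.comp (contMDiff_proj _))]
  simp

theorem mvfderiv_sectionFunction_verticalVector (μ : Sections E F A)
    (p : DualTotal F A) (β : A p.proj →L[ℝ] ℝ) :
    mvfderiv (dualModel E F) (sectionFunction μ) p (verticalVector E p β) = β (μ p.proj) := by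
  rw [mvfderiv_verticalVector (contMDiff_sectionFunction μ)]
  have : (fun t : ℝ => sectionFunction μ ⟨p.proj, p.snd + t • β⟩) =
      fun t => p.snd (μ p.proj) + t * β (μ p.proj) := by
    ext t; simp [sectionFunction]
  rw [this]
  simp

variable [IsManifold 𝓘(ℝ, E) ∞ M]

theorem differentiableAt_comp_extChartAt_symm {G : Type*} [NormedAddCommGroup G] [NormedSpace ℝ G]
    {f : M → G} {x : M} (hf : ContMDiffAt 𝓘(ℝ, E) 𝓘(ℝ, G) ∞ f x) :
    DifferentiableAt ℝ (fun u => f ((extChartAt 𝓘(ℝ, E) x).symm u)) (extChartAt 𝓘(ℝ, E) x x) := by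
  have h1 : ContMDiffAt 𝓘(ℝ, E) 𝓘(ℝ, E) ∞ (extChartAt 𝓘(ℝ, E) x).symm
      (extChartAt 𝓘(ℝ, E) x x) :=
    (contMDiffOn_extChartAt_symm x).contMDiffAt (extChartAt_target_mem_nhds x)
  have h2 : ContMDiffAt 𝓘(ℝ, E) 𝓘(ℝ, G) ∞ (f ∘ (extChartAt 𝓘(ℝ, E) x).symm)
      (extChartAt 𝓘(ℝ, E) x x) := ContMDiffAt.comp _ (by simpa using hf) h1
  exact (contMDiffAt_iff_contDiffAt.1 h2).differentiableAt (by simp)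

variable [ContMDiffVectorBundle ∞ F A 𝓘(ℝ, E)]

/-- In the chart of `A^*` at `p` the bundle projection is the first projection of `E × F^*`. -/
theorem mvfderiv_comp_proj {f : M → ℝ} (hf : ContMDiff 𝓘(ℝ, E) 𝓘(ℝ, ℝ) ∞ f) (p : DualTotal F A)
    (w : E × (F →L[ℝ] ℝ)) :
    mvfderiv (dualModel E F) (f ∘ TotalSpace.proj) p w = mvfderiv 𝓘(ℝ, E) f p.proj w.1 := by
  have hd := differentiableAt_comp_extChartAt_symm (hf p.proj)
  have hp := extChartAt_dual_apply (E := E) p p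
  have hd' : DifferentiableAt ℝ (fun u => f ((extChartAt 𝓘(ℝ, E) p.proj).symm u))
      (extChartAt (dualModel E F) p p).1 := by rw [hp]; exact hd
  rw [mvfderiv_eq_fderiv_of_eventuallyEq (J := 𝓘(ℝ, E)) hd]
  · rw [mvfderiv_eq_fderiv_of_eventuallyEq (J := dualModel E F)
      (Ψ := fun w => f ((extChartAt 𝓘(ℝ, E) p.proj).symm w.1))]
    · have : HasFDerivAt (fun w : E × (F →L[ℝ] ℝ) => f ((extChartAt 𝓘(ℝ, E) p.proj).symm w.1)) _
        (extChartAt (dualModel E F) p p) :=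
        HasFDerivAt.comp (f := Prod.fst) _ hd'.hasFDerivAt hasFDerivAt_fst
      rw [this.fderiv]
      rfl
    · exact DifferentiableAt.comp (f := Prod.fst) _ hd' differentiableAt_fst
    · filter_upwards [eventually_proj_mem
        ((trivializationAt F A p.proj).open_baseSet.mem_nhds (mem_baseSet_trivializationAt F A _)),
        eventually_proj_mem (extChartAt_source_mem_nhds (I := 𝓘(ℝ, E)) p.proj)] with q h1 h2
      simp only [Function.comp, extChartAt_dual_apply p q]
      rw [(extChartAt 𝓘(ℝ, E) p.proj).left_inv h2]
  · filter_upwards [extChartAt_source_mem_nhds (I := 𝓘(ℝ, E)) p.proj] with y hy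
    rw [Function.comp, (extChartAt 𝓘(ℝ, E) p.proj).left_inv hy]

/-- In the chart the function is `(u, β) ↦ β(s(u))`, with `s` the coordinate expression of `μ`. The
two summands are those of the product rule. -/
theorem mvfderiv_sectionFunction (μ : Sections E F A) (p : DualTotal F A)
    (w : E × (F →L[ℝ] ℝ)) :
    mvfderiv (dualModel E F) (sectionFunction μ) p w = w.2 (fiberCoord p.proj (μ p.proj)) +
      (trivializationAt (F →L[ℝ] ℝ) (fun x : M => A x →L[ℝ] ℝ) p.proj p).2
       (fderiv ℝ (fun u => sectionCoord μ p.proj ((extChartAt 𝓘(ℝ, E) p.proj).symm u))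
        (extChartAt 𝓘(ℝ, E) p.proj p.proj) w.1) := by
  have hd := differentiableAt_comp_extChartAt_symm (f := sectionCoord μ p.proj)
    ((contMDiffAt_section (s := fun y => μ y) p.proj).1 (μ.contMDiff p.proj))
  have hp := extChartAt_dual_apply (E := E) p p
  have hd' : DifferentiableAt ℝ
      (fun u => sectionCoord μ p.proj ((extChartAt 𝓘(ℝ, E) p.proj).symm u))
      (extChartAt (dualModel E F) p p).1 := by rw [hp]; exact hd
  have key : HasFDerivAt (fun w : E × (F →L[ℝ] ℝ) =>
      w.2 (sectionCoord μ p.proj ((extChartAt 𝓘(ℝ, E) p.proj).symm w.1))) _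
      (extChartAt (dualModel E F) p p) :=
    HasFDerivAt.clm_apply hasFDerivAt_snd
      (HasFDerivAt.comp (f := Prod.fst) _ hd'.hasFDerivAt hasFDerivAt_fst)
  rw [mvfderiv_eq_fderiv_of_eventuallyEq (J := dualModel E F) key.differentiableAt, key.fderiv, hp]
  · dsimp only
    rw [extChartAt_to_inv, fiberCoord_apply, add_comm (w.2 _)]
    rfl
  · filter_upwards [eventually_proj_mem
      ((trivializationAt F A p.proj).open_baseSet.mem_nhds (mem_baseSet_trivializationAt F A _)),
      eventually_proj_mem (extChartAt_source_mem_nhds (I := 𝓘(ℝ, E)) p.proj)] with q h1 h2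
    simp only [Function.comp, extChartAt_dual_apply p q]
    rw [(extChartAt 𝓘(ℝ, E) p.proj).left_inv h2]
    exact (trivializationAt_dual_snd h1 q.snd (μ q.proj)).symm

/-- On the zero section the term containing the derivative of `μ` drops out. Hence the differential
depends only on `μ x`, which is what makes the anchor and the cocycle pointwise linear in `A`. -/
theorem mvfderiv_sectionFunction_zero (μ : Sections E F A) (x : M) (w : E × (F →L[ℝ] ℝ)) :
    mvfderiv (dualModel E F) (sectionFunction μ) ⟨x, 0⟩ w = w.2 (fiberCoord x (μ x)) := by
  have h : (trivializationAt (F →L[ℝ] ℝ) (fun x : M => A x →L[ℝ] ℝ) x ⟨x, 0⟩).2 = 0 :=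
    ((trivializationAt (F →L[ℝ] ℝ) (fun x : M => A x →L[ℝ] ℝ) x).linear ℝ
      (mem_baseSet_trivializationAt (F →L[ℝ] ℝ) (fun x : M => A x →L[ℝ] ℝ) x)).map_zero
  have := mvfderiv_sectionFunction μ ⟨x, 0⟩ w
  simpa [h] using this

end DualBundle

/-! ### Frames, sections and linear functions -/

theorem ContinuousLinearMap.apply_eq_sum_basis {ι V W : Type*} [Fintype ι] [AddCommGroup V]
    [Module ℝ V] [TopologicalSpace V] [AddCommGroup W] [Module ℝ W] [TopologicalSpace W]
    (b : Module.Basis ι ℝ V) (L : V →L[ℝ] W) (a : V) : L a = ∑ i, b.repr a i • L (b i) := by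
  conv_lhs => rw [← b.sum_repr a, map_sum]
  simp only [map_smul]

section Frames

variable {E : Type*} [NormedAddCommGroup E] [NormedSpace ℝ E] [FiniteDimensional ℝ E]
  {M : Type*} [TopologicalSpace M] [T2Space M] [ChartedSpace E M] [IsManifold 𝓘(ℝ, E) ∞ M]
  {F : Type*} [NormedAddCommGroup F] [NormedSpace ℝ F] [FiniteDimensional ℝ F]
  {A : M → Type*} [TopologicalSpace (TotalSpace F A)] [∀ x, AddCommGroup (A x)]
  [∀ x, Module ℝ (A x)] [∀ x, TopologicalSpace (A x)] [FiberBundle F A] [VectorBundle ℝ F A]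
  [ContMDiffVectorBundle ∞ F A 𝓘(ℝ, E)]

theorem eventually_frame_eq (x : M) (i : Fin (Module.finrank ℝ F)) :
    ∀ᶠ y in 𝓝 x, frame E F A x i y =
      (trivializationAt F A x).localFrame (Module.finBasis ℝ F) i y :=
  (exists_section_eq_localFrame E F A x i).choose_spec

theorem eventually_frame_eq_symmL (x : M) (i : Fin (Module.finrank ℝ F)) :
    ∀ᶠ y in 𝓝 x, frame E F A x i y =
      (trivializationAt F A x).symmL ℝ y (Module.finBasis ℝ F i) := by
  filter_upwards [eventually_frame_eq (E := E) (A := A) x i,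
    (trivializationAt F A x).open_baseSet.mem_nhds (mem_baseSet_trivializationAt F A x)] with y h hy
  rw [h, Trivialization.localFrame_apply_of_mem_baseSet _ _ hy, Trivialization.basisAt]
  simp [hy]

theorem frame_self (x : M) (i : Fin (Module.finrank ℝ F)) :
    frame E F A x i x = (trivializationAt F A x).basisAt (Module.finBasis ℝ F)
      (mem_baseSet_trivializationAt F A x) i := by
  rw [(eventually_frame_eq x i).self_of_nhds, Trivialization.localFrame_apply_of_mem_baseSet]

theorem eventually_sectionCoord_frame (x : M) (i : Fin (Module.finrank ℝ F)) :
    ∀ᶠ y in 𝓝 x, sectionCoord (frame E F A x i) x y = Module.finBasis ℝ F i := by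
  filter_upwards [eventually_frame_eq_symmL (E := E) (A := A) x i,
    (trivializationAt F A x).open_baseSet.mem_nhds (mem_baseSet_trivializationAt F A x)] with y h hy
  rw [sectionCoord, h]
  simp [hy]

theorem fiberCoord_frame (x : M) (i : Fin (Module.finrank ℝ F)) :
    fiberCoord x (frame E F A x i x) = Module.finBasis ℝ F i := by
  rw [fiberCoord_apply]
  exact (eventually_sectionCoord_frame x i).self_of_nhds

/-- There is a section of `A` through every vector of `A`. -/
theorem exists_section_apply_eq {x : M} (a : A x) : ∃ μ : Sections E F A, μ x = a := by
  set b := (trivializationAt F A x).basisAt (Module.finBasis ℝ F)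
      (mem_baseSet_trivializationAt F A x)
  refine ⟨∑ i, b.repr a i • frame E F A x i, ?_⟩
  rw [← ContMDiffSection.coeAddHom_apply, map_sum, Finset.sum_apply]
  conv_rhs => rw [← b.sum_repr a]
  refine Finset.sum_congr rfl fun i _ => ?_
  rw [ContMDiffSection.coeAddHom_apply, ContMDiffSection.coe_smul, Pi.smul_apply, frame_self]

/-- The frame has constant coordinates near the base point, so its derivative term vanishes at every
point of the fibre and not only at zero. -/
theorem mvfderiv_sectionFunction_frame (p : DualTotal F A) (i : Fin (Module.finrank ℝ F))
    (w : E × (F →L[ℝ] ℝ)) :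
    mvfderiv (dualModel E F) (sectionFunction (frame E F A p.proj i)) p w =
      w.2 (Module.finBasis ℝ F i) := by
  have h : (fun u => sectionCoord (frame E F A p.proj i) p.proj
      ((extChartAt 𝓘(ℝ, E) p.proj).symm u)) =ᶠ[𝓝 (extChartAt 𝓘(ℝ, E) p.proj p.proj)]
      fun _ => Module.finBasis ℝ F i := by
    have ht := continuousAt_extChartAt_symm (I := 𝓘(ℝ, E)) p.proj
    rw [ContinuousAt, extChartAt_to_inv] at ht
    exact ht.eventually (eventually_sectionCoord_frame p.proj i)
  rw [mvfderiv_sectionFunction, fiberCoord_frame, h.fderiv_eq]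
  simp

/-- The differentials of basic functions and of linear functions span the cotangent spaces
of `A^*`. -/
theorem exists_covector_eq (p : DualTotal F A) (ξ : TangentSpace (dualModel E F) p →L[ℝ] ℝ) :
    ∃ f : M → ℝ, ContMDiff 𝓘(ℝ, E) 𝓘(ℝ, ℝ) ∞ f ∧ ∃ c : Fin (Module.finrank ℝ F) → ℝ,
      ξ = mvfderiv (dualModel E F) (f ∘ TotalSpace.proj) p +
        ∑ i, c i • mvfderiv (dualModel E F) (sectionFunction (frame E F A p.proj i)) p := by
  let ξ' : E × (F →L[ℝ] ℝ) →L[ℝ] ℝ := ξ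
  -- At `p` the frame functions have purely vertical differentials, so `f` must carry the
  -- restriction of `ξ` to `E`, and the `c i` are the components of `ξ` on `F^*`.
  obtain ⟨f, hf, hfx⟩ := exists_contMDiff_eventuallyEq_chart E p.proj
    (ξ'.comp (ContinuousLinearMap.inl ℝ E (F →L[ℝ] ℝ)))
  refine ⟨f, hf, fun i => ξ' (0, LinearMap.toContinuousLinearMap ((Module.finBasis ℝ F).coord i)),
    ?_⟩
  ext w
  rw [add_apply, sum_apply]
  simp only [smul_apply, smul_eq_mul]
  obtain ⟨v, β⟩ : E × (F →L[ℝ] ℝ) := w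
  have hβ : β = ∑ i, β (Module.finBasis ℝ F i) •
      LinearMap.toContinuousLinearMap ((Module.finBasis ℝ F).coord i) := by
    ext a
    rw [β.apply_eq_sum_basis (Module.finBasis ℝ F)]
    simp [mul_comm]
  have e1 : ξ' (v, β) = ξ' (v, 0) + ξ' (0, β) := by rw [← map_add]; simp
  have e2 : ξ' (0, β) = ∑ i, β (Module.finBasis ℝ F i) *
      ξ' (0, LinearMap.toContinuousLinearMap ((Module.finBasis ℝ F).coord i)) := by
    conv_lhs => rw [hβ]
    have : ((0 : E), ∑ i, β (Module.finBasis ℝ F i) •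
      LinearMap.toContinuousLinearMap ((Module.finBasis ℝ F).coord i)) =
      ∑ i, β (Module.finBasis ℝ F i) • ((0 : E),
        LinearMap.toContinuousLinearMap ((Module.finBasis ℝ F).coord i)) := by
      ext <;> simp [Prod.fst_sum, Prod.snd_sum]
    rw [this, map_sum]
    simp only [map_smul, smul_eq_mul]
  change ξ' (v, β) = mvfderiv (dualModel E F) (f ∘ TotalSpace.proj) p (v, β) +
    ∑ i, ξ' (0, LinearMap.toContinuousLinearMap ((Module.finBasis ℝ F).coord i)) *
      mvfderiv (dualModel E F) (sectionFunction (frame E F A p.proj i)) p (v, β)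
  rw [mvfderiv_comp_proj hf, mvfderiv_eq_of_eventuallyEq_chart _ hfx, e1, e2]
  congr 1
  refine Finset.sum_congr rfl fun i _ => ?_
  rw [mvfderiv_sectionFunction_frame, mul_comm]

theorem covector_linearMap_ext {G : Type*} [AddCommGroup G] [Module ℝ G] {p : DualTotal F A}
    {L L' : (TangentSpace (dualModel E F) p →L[ℝ] ℝ) →ₗ[ℝ] G}
    (h1 : ∀ f : M → ℝ, ContMDiff 𝓘(ℝ, E) 𝓘(ℝ, ℝ) ∞ f →
      L (mvfderiv (dualModel E F) (f ∘ TotalSpace.proj) p) =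
      L' (mvfderiv (dualModel E F) (f ∘ TotalSpace.proj) p))
    (h2 : ∀ i, L (mvfderiv (dualModel E F) (sectionFunction (frame E F A p.proj i)) p) =
      L' (mvfderiv (dualModel E F) (sectionFunction (frame E F A p.proj i)) p)) : L = L' := by
  ext ξ
  obtain ⟨f, hf, c, rfl⟩ := exists_covector_eq p ξ
  simp [h1 f hf, h2]

/-- A family of linear maps between the fibres of two vector bundles is smooth if it maps smooth
sections to smooth sections. -/
theorem contMDiff_hom_of_forall {G : Type*} [NormedAddCommGroup G] [NormedSpace ℝ G]
    {B : M → Type*} [TopologicalSpace (TotalSpace G B)] [∀ x, AddCommGroup (B x)]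
    [∀ x, Module ℝ (B x)] [∀ x, TopologicalSpace (B x)] [∀ x, IsTopologicalAddGroup (B x)]
    [∀ x, ContinuousSMul ℝ (B x)] [FiberBundle G B] [VectorBundle ℝ G B]
    (T : ∀ x, A x →L[ℝ] B x)
    (h : ∀ μ : Sections E F A, ContMDiff 𝓘(ℝ, E) (𝓘(ℝ, E).prod 𝓘(ℝ, G)) ∞
      (fun x => TotalSpace.mk' G x (T x (μ x)))) :
    ContMDiff 𝓘(ℝ, E) (𝓘(ℝ, E).prod 𝓘(ℝ, F →L[ℝ] G)) ∞
      (fun x => TotalSpace.mk' (F →L[ℝ] G) (E := fun x => A x →L[ℝ] B x) x (T x)) := by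
  intro x
  refine (contMDiffAt_hom_bundle _).2 ⟨contMDiffAt_id, ?_⟩
  set b := Module.finBasis ℝ F
  have e (L : F →L[ℝ] G) : L = ∑ i, ContinuousLinearMap.smulRightL ℝ F G
      (LinearMap.toContinuousLinearMap (b.coord i)) (L (b i)) := by
    ext a
    rw [L.apply_eq_sum_basis b]
    simp
  suffices hs : ∀ i, ContMDiffAt 𝓘(ℝ, E) 𝓘(ℝ, G) ∞ (fun y =>
      ContinuousLinearMap.inCoordinates F A G B x y x y (T y) (b i)) x by
    rw [show (fun y => ContinuousLinearMap.inCoordinates F A G B x y x y (T y)) = _ from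
      funext fun y => e _]
    exact contMDiffAt_finsetSum fun i _ =>
      (ContinuousLinearMap.smulRightL ℝ F G
        (LinearMap.toContinuousLinearMap (b.coord i))).contMDiff.contMDiffAt.comp x (hs i)
  intro i
  -- Near `x` the frame section has constant coordinate `b i`, so the image of `b i` in coordinates
  -- is the coordinate expression of `T` applied to that section.
  refine ((contMDiffAt_section x).1 (h (frame E F A x i) x)).congr_of_eventuallyEq ?_
  filter_upwards [eventually_frame_eq_symmL (E := E) (A := A) x i,
    (trivializationAt F A x).open_baseSet.mem_nhds (mem_baseSet_trivializationAt F A x),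
    (trivializationAt G B x).open_baseSet.mem_nhds (mem_baseSet_trivializationAt G B x)]
    with y hy h1 h2
  rw [ContinuousLinearMap.inCoordinates_eq h1 h2, hy]
  simp [h1]
  rfl

/-- Linear functions on `A^*` come from sections of `A`. -/
theorem exists_section_of_isLinearFunction {h : DualTotal F A → ℝ} (hh : IsLinearFunction E h) :
    ∃ μ : Sections E F A, ∀ p, h p = sectionFunction μ p := by
  set b := Module.finBasis ℝ F
  -- The `c x y i` form the coframe over `y` dual to the frame of the trivialization at `x`. The
  -- vector `m x y` has the values of `h` on this coframe as its components, so it represents `h` on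
  -- the fibre over `y`.
  let c (x y : M) (i) : A y →L[ℝ] ℝ :=
    (LinearMap.toContinuousLinearMap (b.coord i)).comp
      ((trivializationAt F A x).continuousLinearMapAt ℝ y)
  let m (x y : M) : A y := ∑ i, h ⟨y, c x y i⟩ • (trivializationAt F A x).symmL ℝ y (b i)
  have hm (x y : M) (hy : y ∈ (trivializationAt F A x).baseSet) (α : A y →L[ℝ] ℝ) :
      α (m x y) = h ⟨y, α⟩ := by
    have hα : α = ∑ i, α ((trivializationAt F A x).symmL ℝ y (b i)) • c x y i := by
      ext a
      have ha : a = (trivializationAt F A x).symmL ℝ y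
          ((trivializationAt F A x).continuousLinearMapAt ℝ y a) := by
        rw [Trivialization.symmL_continuousLinearMapAt _ hy]
      have := (α.comp ((trivializationAt F A x).symmL ℝ y)).apply_eq_sum_basis b
        ((trivializationAt F A x).continuousLinearMapAt ℝ y a)
      rw [ContinuousLinearMap.comp_apply, ← ha] at this
      rw [this]
      simp [c, mul_comm]
    let H : (A y →L[ℝ] ℝ) →ₗ[ℝ] ℝ := (hh.2 y).mk'
    have : H α = ∑ i, α ((trivializationAt F A x).symmL ℝ y (b i)) * H (c x y i) := by
      conv_lhs => rw [hα]
      simp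
    change _ = H α
    rw [this]
    simp only [m, map_sum, map_smul, smul_eq_mul]
    exact Finset.sum_congr rfl fun i _ => mul_comm _ _
  -- The representing vector is unique, so the choice of trivialization does not matter: `m y y` is
  -- global, and near `x` it equals the smooth `m x y`.
  have hloc (x y : M) (hy : y ∈ (trivializationAt F A x).baseSet) : m y y = m x y :=
    dual_ext (F := F) fun α => by
      rw [hm y y (mem_baseSet_trivializationAt F A y), hm x y hy]
  refine ⟨⟨fun y => m y y, fun x => ?_⟩, fun p =>
    (hm p.proj p.proj (mem_baseSet_trivializationAt F A p.proj) p.snd).symm⟩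
  have hx := (trivializationAt F A x).open_baseSet.mem_nhds (mem_baseSet_trivializationAt F A x)
  refine ContMDiffAt.congr_of_eventuallyEq (f := fun y => TotalSpace.mk' F y (m x y)) ?_ ?_
  · refine ContMDiffAt.sum_section fun i _ => ContMDiffAt.smul_section ?_ ?_
    · have hc : ContMDiffAt 𝓘(ℝ, E) (dualModel E F) ∞ (fun y => (⟨y, c x y i⟩ : DualTotal F A)) x := by
        refine (contMDiffAt_hom_bundle (E₂ := Bundle.Trivial M ℝ) _).2 ⟨contMDiffAt_id, ?_⟩
        refine (contMDiffAt_const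
          (c := LinearMap.toContinuousLinearMap (b.coord i))).congr_of_eventuallyEq ?_
        filter_upwards [hx] with y hy
        rw [ContinuousLinearMap.inCoordinates_eq hy (by simp)]
        ext a
        simp [c, hy]
      exact (hh.1 _).comp x hc
    · refine ((frame E F A x i).contMDiff x).congr_of_eventuallyEq ?_
      filter_upwards [eventually_frame_eq_symmL (E := E) (A := A) x i] with y hy
      rw [hy]
  · filter_upwards [hx] with y hy
    rw [hloc x y hy]

end Frames

/-! ### Jacobi brackets of basic and linear functions -/

section BracketLinearity

variable {E : Type*} [NormedAddCommGroup E] [NormedSpace ℝ E] {H : Type*} [TopologicalSpace H]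
  {J : ModelWithCorners ℝ E H} {N : Type*} [TopologicalSpace N] [ChartedSpace H N]

theorem BivectorField.onFun_const_right (P : BivectorField J N) (f : N → ℝ) (c : ℝ) (p : N) :
    P.onFun f (fun _ => c) p = 0 := by
  simp [BivectorField.onFun, mvfderiv_const]

variable [IsManifold J ∞ N]

theorem applyField_const (X : Cₛ^∞⟮J; E, (TangentSpace J : N → Type _)⟯) (c : ℝ) (p : N) :
    applyField X (fun _ => c) p = 0 := by
  simp [applyField, mvfderiv_const]

namespace JacobiStructure

variable (S : JacobiStructure J N) {f g h : N → ℝ}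

theorem bracket_swap (f g : N → ℝ) (p : N) : S.bracket f g p = -S.bracket g f p := by
  rw [S.bracket_apply, S.bracket_apply, S.bivector.onFun_swap]; ring

theorem bracket_self (f : N → ℝ) (p : N) : S.bracket f f p = 0 := by
  rw [S.bracket_apply, S.bivector.onFun_self]; ring

theorem bracket_add_right (hg : ContMDiff J 𝓘(ℝ, ℝ) ∞ g)
    (hh : ContMDiff J 𝓘(ℝ, ℝ) ∞ h) (p : N) :
    S.bracket f (g + h) p = S.bracket f g p + S.bracket f h p := by
  simp only [S.bracket_apply, S.bivector.onFun_add_right hg hh, applyField_add _ hg hh,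
    Pi.add_apply]
  ring

/-- The Leibniz rule of a Jacobi bracket, a first-order differential operator in each argument. -/
theorem bracket_mul_right (hg : ContMDiff J 𝓘(ℝ, ℝ) ∞ g)
    (hh : ContMDiff J 𝓘(ℝ, ℝ) ∞ h) (p : N) :
    S.bracket f (g * h) p = g p * S.bracket f h p + h p * S.bivector.onFun f g p
      + f p * h p * applyField S.field g p := by
  simp only [S.bracket_apply, S.bivector.onFun_mul_right hg hh, applyField_mul _ hg hh,
    Pi.mul_apply]
  ring

theorem bracket_const_smul_right (c : ℝ) (hg : ContMDiff J 𝓘(ℝ, ℝ) ∞ g) (p : N) :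
    S.bracket f (c • g) p = c * S.bracket f g p := by
  have : c • g = (fun _ => c) * g := rfl
  rw [this, S.bracket_mul_right contMDiff_const hg, S.bivector.onFun_const_right,
    applyField_const]
  ring

end JacobiStructure

end BracketLinearity

/-! ### Algebra of basic and linear functions. -/

section BasicAndLinearFunctions

variable {E : Type*} [NormedAddCommGroup E] [NormedSpace ℝ E]
  {M : Type*} [TopologicalSpace M] [ChartedSpace E M]
  {F : Type*} [NormedAddCommGroup F] [NormedSpace ℝ F]
  {A : M → Type*} [TopologicalSpace (TotalSpace F A)] [∀ x, AddCommGroup (A x)]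
  [∀ x, Module ℝ (A x)] [∀ x, TopologicalSpace (A x)] [FiberBundle F A] [VectorBundle ℝ F A]

theorem sectionFunction_smulSection (f : M → ℝ) (hf : ContMDiff 𝓘(ℝ, E) 𝓘(ℝ, ℝ) ∞ f)
    (η : Sections E F A) :
    sectionFunction (smulSection f hf η) = (f ∘ TotalSpace.proj) * sectionFunction η := by
  ext p
  exact map_smul p.snd (f p.proj) (η p.proj)

theorem sectionFunction_add (μ η : Sections E F A) :
    sectionFunction (μ + η) = sectionFunction μ + sectionFunction η := by
  ext p
  exact map_add p.snd (μ p.proj) (η p.proj)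

theorem sectionFunction_smul (c : ℝ) (μ : Sections E F A) :
    sectionFunction (c • μ) = c • sectionFunction μ := by
  ext p
  exact map_smul p.snd c (μ p.proj)

theorem ContMDiff.comp_dual_proj {f : M → ℝ} (hf : ContMDiff 𝓘(ℝ, E) 𝓘(ℝ, ℝ) ∞ f) :
    ContMDiff (dualModel E F) 𝓘(ℝ, ℝ) ∞ (f ∘ TotalSpace.proj : DualTotal F A → ℝ) :=
  hf.comp (contMDiff_proj _)

theorem ContMDiff.comp_dual_zero {g : DualTotal F A → ℝ}
    (hg : ContMDiff (dualModel E F) 𝓘(ℝ, ℝ) ∞ g) :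
    ContMDiff 𝓘(ℝ, E) 𝓘(ℝ, ℝ) ∞ (fun x => g ⟨x, 0⟩) :=
  hg.comp (contMDiff_zeroSection ℝ (fun x : M => A x →L[ℝ] ℝ))

theorem isBasicFunction_of_forall {g : DualTotal F A → ℝ}
    (hg : ContMDiff (dualModel E F) 𝓘(ℝ, ℝ) ∞ g) (h : ∀ p : DualTotal F A, g p = g ⟨p.proj, 0⟩) :
    IsBasicFunction E g :=
  ⟨_, hg.comp_dual_zero, h⟩

theorem IsBasicFunction.apply_eq_zero_section {g : DualTotal F A → ℝ} (hg : IsBasicFunction E g)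
    (p : DualTotal F A) : g p = g ⟨p.proj, 0⟩ := by
  obtain ⟨f, -, h⟩ := hg
  rw [h, h]

/-- Continuity along a line through zero. It supplies the value at the zero covector, where every
linear function vanishes and division by one is impossible. -/
theorem apply_zero_eq_of_line {g : DualTotal F A → ℝ}
    (hg : ContMDiff (dualModel E F) 𝓘(ℝ, ℝ) ∞ g) {x : M} {β : A x →L[ℝ] ℝ} {c : ℝ}
    (h : ∀ t : ℝ, t ≠ 0 → g ⟨x, t • β⟩ = c) : g ⟨x, 0⟩ = c := by
  have hc : Continuous (fun t : ℝ => g ⟨x, 0 + t • β⟩) :=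
    hg.continuous.comp (contMDiff_fiber_line (E := E) x 0 β).continuous
  have h1 := (hc.tendsto 0).mono_left (nhdsWithin_le_nhds (s := {0}ᶜ))
  have h2 : Filter.Tendsto (fun t : ℝ => g ⟨x, 0 + t • β⟩) (𝓝[≠] 0) (𝓝 c) := by
    refine tendsto_const_nhds.congr' ?_
    filter_upwards [self_mem_nhdsWithin] with t ht
    rw [zero_add, h t ht]
  simpa using tendsto_nhds_unique h1 h2

end BasicAndLinearFunctions

/-! ### Consequences of (C1) and (C2) for `Λ` and `E`. -/

section LinearJacobi

variable {E : Type*} [NormedAddCommGroup E] [NormedSpace ℝ E] [FiniteDimensional ℝ E]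
  {M : Type*} [TopologicalSpace M] [T2Space M] [ChartedSpace E M] [IsManifold 𝓘(ℝ, E) ∞ M]
  {F : Type*} [NormedAddCommGroup F] [NormedSpace ℝ F] [FiniteDimensional ℝ F]
  {A : M → Type*} [TopologicalSpace (TotalSpace F A)] [∀ x, AddCommGroup (A x)]
  [∀ x, Module ℝ (A x)] [∀ x, TopologicalSpace (A x)] [FiberBundle F A] [VectorBundle ℝ F A]
  [ContMDiffVectorBundle ∞ F A 𝓘(ℝ, E)]

theorem exists_section_apply_ne_zero {x : M} {α : A x →L[ℝ] ℝ} (hα : α ≠ 0) :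
    ∃ μ : Sections E F A, α (μ x) ≠ 0 := by
  obtain ⟨a, ha⟩ : ∃ a, α a ≠ 0 := by
    by_contra! h
    exact hα (ContinuousLinearMap.ext h)
  obtain ⟨μ, rfl⟩ := exists_section_apply_eq (E := E) (F := F) a
  exact ⟨μ, ha⟩

/-- A function whose products with all linear functions are basic vanishes. -/
theorem eq_zero_of_mul_isBasicFunction (hrank : 0 < Module.finrank ℝ F) {g : DualTotal F A → ℝ}
    (hg : ContMDiff (dualModel E F) 𝓘(ℝ, ℝ) ∞ g)
    (h : ∀ μ : Sections E F A, IsBasicFunction E (g * sectionFunction μ)) (p : DualTotal F A) :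
    g p = 0 := by
  -- A basic function has the same value at `α` as at zero, where the product vanishes; then divide
  -- by some `α (μ x) ≠ 0`.
  have key (x : M) (α : A x →L[ℝ] ℝ) (hα : α ≠ 0) : g ⟨x, α⟩ = 0 := by
    obtain ⟨μ, hμ⟩ := exists_section_apply_ne_zero (E := E) (F := F) hα
    have := (h μ).apply_eq_zero_section ⟨x, α⟩
    simp only [Pi.mul_apply, sectionFunction, zero_apply, mul_zero, mul_eq_zero] at this
    exact this.resolve_right hμ
  obtain ⟨x, α⟩ := p
  rcases eq_or_ne α 0 with rfl | hα
  -- Positive rank provides a nonzero covector along which to approach zero.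
  · let i : Fin (Module.finrank ℝ F) := ⟨0, hrank⟩
    let β : A x →L[ℝ] ℝ :=
      (LinearMap.toContinuousLinearMap ((Module.finBasis ℝ F).coord i)).comp (fiberCoord x)
    have hβ : β ≠ 0 := by
      intro h0
      have : β (frame E F A x i x) = 0 := by rw [h0]; rfl
      simp only [β, ContinuousLinearMap.comp_apply, fiberCoord_frame] at this
      simp at this
    exact apply_zero_eq_of_line hg fun t ht => key x _ (smul_ne_zero ht hβ)
  · exact key x α hα

/-- A function whose products with all linear functions are linear is constant on the fibres. -/
theorem eq_zero_section_of_mul_isLinearFunction {g : DualTotal F A → ℝ}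
    (hg : ContMDiff (dualModel E F) 𝓘(ℝ, ℝ) ∞ g)
    (h : ∀ μ : Sections E F A, IsLinearFunction E (g * sectionFunction μ)) (p : DualTotal F A) :
    g p = g ⟨p.proj, 0⟩ := by
  obtain ⟨x, α⟩ := p
  rcases eq_or_ne α 0 with rfl | hα
  · rfl
  · obtain ⟨μ, hμ⟩ := exists_section_apply_ne_zero (E := E) (F := F) hα
    -- Homogeneity of `g μ~` gives `g(tα) t α(μ) = t g(α) α(μ)`, so `g` is constant on the punctured
    -- line.
    refine (apply_zero_eq_of_line (β := α) hg fun t ht => ?_).symm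
    have := ((h μ).2 x).map_smul t α
    simp only [Pi.mul_apply, sectionFunction, smul_apply, smul_eq_mul] at this
    have h2 : t * α (μ x) ≠ 0 := mul_ne_zero ht hμ
    apply mul_right_cancel₀ h2
    linear_combination this

variable (S : JacobiStructure (dualModel E F) (DualTotal F A))

namespace JacobiStructure

/-- The bracket of two linear functions is linear. -/
def BracketIsLinear : Prop :=
  ∀ f g : DualTotal F A → ℝ, IsLinearFunction E f → IsLinearFunction E g →
    IsLinearFunction E (S.bracket f g)

/-- The bracket of a linear function and the constant function `1` is basic. -/
def BracketOneIsBasic : Prop :=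
  ∀ f : DualTotal F A → ℝ, IsLinearFunction E f → IsBasicFunction E (S.bracket f 1)

/-- Because `{μ~, 1} = -E(μ~)`, this is (C2) with "basic" expressed as equality with the value on
the zero section. -/
theorem applyField_sectionFunction_eq (C2 : S.BracketOneIsBasic)
    (μ : Sections E F A) (p : DualTotal F A) :
    applyField S.field (sectionFunction μ) p =
      applyField S.field (sectionFunction μ) ⟨p.proj, 0⟩ := by
  have h := (C2 _ (isLinearFunction_sectionFunction μ)).apply_eq_zero_section p
  have e (q : DualTotal F A) : S.bracket (sectionFunction μ) 1 q =
      -applyField S.field (sectionFunction μ) q := by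
    have h1 := S.bivector.onFun_const_right (sectionFunction μ) 1 q
    have h2 := applyField_const S.field 1 q
    change S.bracket (sectionFunction μ) (fun _ => 1) q = _
    rw [S.bracket_apply, h1, h2]
    ring
  rw [e, e] at h
  linarith

/-- In `E(f μ~) = f E(μ~) + μ~ E(f)` the first two terms are basic, hence so is `μ~ E(f)` for every
`μ`. -/
theorem applyField_comp_proj (hrank : 0 < Module.finrank ℝ F) (C2 : S.BracketOneIsBasic)
    {f : M → ℝ} (hf : ContMDiff 𝓘(ℝ, E) 𝓘(ℝ, ℝ) ∞ f)
    (p : DualTotal F A) : applyField S.field (f ∘ TotalSpace.proj) p = 0 := by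
  have hfE := contMDiff_applyField S.field (hf.comp_dual_proj (F := F) (A := A))
  refine eq_zero_of_mul_isBasicFunction (E := E) hrank hfE (fun μ => ?_) p
  refine isBasicFunction_of_forall (hfE.mul (contMDiff_sectionFunction μ)) fun q => ?_
  have h (q : DualTotal F A) :=
    applyField_mul S.field (hf.comp_dual_proj (F := F) (A := A)) (contMDiff_sectionFunction μ) q
  have h1 := S.applyField_sectionFunction_eq C2 (smulSection f hf μ) q
  rw [sectionFunction_smulSection, h, h, S.applyField_sectionFunction_eq C2 μ q] at h1
  simp only [Function.comp, Pi.mul_apply] at h1 ⊢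
  linarith

/-- As `E(f) = 0`, the Leibniz rule gives `Λ(dμ~, df) η~ = {μ~, f η~} - f {μ~, η~}`, which is linear
for every `η`. -/
theorem onFun_sectionFunction_comp_proj_eq (hrank : 0 < Module.finrank ℝ F) (C1 : S.BracketIsLinear)
    (C2 : S.BracketOneIsBasic)
    (μ : Sections E F A) {f : M → ℝ}
    (hf : ContMDiff 𝓘(ℝ, E) 𝓘(ℝ, ℝ) ∞ f) (p : DualTotal F A) :
    S.bivector.onFun (sectionFunction μ) (f ∘ TotalSpace.proj) p =
      S.bivector.onFun (sectionFunction μ) (f ∘ TotalSpace.proj) ⟨p.proj, 0⟩ := by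
  have hfp := hf.comp_dual_proj (F := F) (A := A)
  have hg := S.bivector.contMDiff_onFun (contMDiff_sectionFunction μ) hfp
  refine eq_zero_section_of_mul_isLinearFunction hg (fun η => ?_) p
  have e : S.bivector.onFun (sectionFunction μ) (f ∘ TotalSpace.proj) * sectionFunction η =
      S.bracket (sectionFunction μ) (sectionFunction (smulSection f hf η)) -
        (f ∘ TotalSpace.proj) * S.bracket (sectionFunction μ) (sectionFunction η) := by
    ext q
    rw [sectionFunction_smulSection]
    simp only [Pi.mul_apply, Pi.sub_apply]
    rw [S.bracket_mul_right hfp (contMDiff_sectionFunction η),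
      S.applyField_comp_proj hrank C2 hf]
    ring
  refine ⟨hg.mul (contMDiff_sectionFunction η), fun x => ?_⟩
  rw [e]
  have h1 := (C1 _ _ (isLinearFunction_sectionFunction μ)
    (isLinearFunction_sectionFunction (smulSection f hf η))).2 x
  have h2 := (C1 _ _ (isLinearFunction_sectionFunction μ) (isLinearFunction_sectionFunction η)).2 x
  constructor
  · intro α β
    have a1 := h1.map_add α β
    have a2 := h2.map_add α β
    simp only [Pi.mul_apply, Pi.sub_apply, Function.comp]
    linear_combination a1 - f x * a2
  · intro c α
    have a1 := h1.map_smul c α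
    have a2 := h2.map_smul c α
    simp only [Pi.mul_apply, Pi.sub_apply, Function.comp, smul_eq_mul] at a1 a2 ⊢
    linear_combination a1 - f x * a2

/-- In `Λ(d(f μ~), dg) = f Λ(dμ~, dg) + μ~ Λ(df, dg)` all terms but the last are already known to be
basic, so the last one is too. -/
theorem onFun_comp_proj_comp_proj (hrank : 0 < Module.finrank ℝ F) (C1 : S.BracketIsLinear)
    (C2 : S.BracketOneIsBasic)
    {f g : M → ℝ} (hf : ContMDiff 𝓘(ℝ, E) 𝓘(ℝ, ℝ) ∞ f)
    (hg : ContMDiff 𝓘(ℝ, E) 𝓘(ℝ, ℝ) ∞ g) (p : DualTotal F A) :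
    S.bivector.onFun (f ∘ TotalSpace.proj) (g ∘ TotalSpace.proj) p = 0 := by
  have hfp := hf.comp_dual_proj (F := F) (A := A)
  have hgp := hg.comp_dual_proj (F := F) (A := A)
  have hP := S.bivector.contMDiff_onFun hfp hgp
  refine eq_zero_of_mul_isBasicFunction (E := E) hrank hP (fun μ => ?_) p
  refine isBasicFunction_of_forall (hP.mul (contMDiff_sectionFunction μ)) fun q => ?_
  have h (q : DualTotal F A) := S.bivector.onFun_mul_left (f := g ∘ TotalSpace.proj) hfp
    (contMDiff_sectionFunction μ) q
  have h1 := S.onFun_sectionFunction_comp_proj_eq hrank C1 C2 (smulSection f hf μ) hg q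
  rw [sectionFunction_smulSection, h, h,
    S.onFun_sectionFunction_comp_proj_eq hrank C1 C2 μ hg q] at h1
  simp only [Function.comp, Pi.mul_apply] at h1 ⊢
  linarith

end JacobiStructure

end LinearJacobi

/-! ### The Lie algebroid and the 1-cocycle of a Jacobi structure on the dual bundle -/

section AlgebroidOfJacobi

variable {E : Type*} [NormedAddCommGroup E] [NormedSpace ℝ E] [FiniteDimensional ℝ E]
  {M : Type*} [TopologicalSpace M] [T2Space M] [ChartedSpace E M] [IsManifold 𝓘(ℝ, E) ∞ M]
  {F : Type*} [NormedAddCommGroup F] [NormedSpace ℝ F] [FiniteDimensional ℝ F]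
  {A : M → Type*} [TopologicalSpace (TotalSpace F A)] [∀ x, AddCommGroup (A x)]
  [∀ x, Module ℝ (A x)] [∀ x, TopologicalSpace (A x)] [FiberBundle F A] [VectorBundle ℝ F A]
  [ContMDiffVectorBundle ∞ F A 𝓘(ℝ, E)]

variable (E F A) in
/-- The covector `(v, β) ↦ β a` at a point of the zero section of `A^*`. -/
def verticalCovector (x : M) :
    F →ₗ[ℝ] (TangentSpace (dualModel E F) (⟨x, 0⟩ : DualTotal F A) →L[ℝ] ℝ) where
  toFun a := ((ContinuousLinearMap.apply ℝ ℝ a).comp (ContinuousLinearMap.snd ℝ E (F →L[ℝ] ℝ)) :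
    E × (F →L[ℝ] ℝ) →L[ℝ] ℝ)
  map_add' a b := ContinuousLinearMap.ext fun w : E × (F →L[ℝ] ℝ) => map_add w.2 a b
  map_smul' c a := ContinuousLinearMap.ext fun w : E × (F →L[ℝ] ℝ) => map_smul w.2 c a

variable (E F A) in
/-- The pullback to `A^*` of a covector on `M`, at a point of the zero section. -/
def baseCovector (x : M) :
    (E →L[ℝ] ℝ) →ₗ[ℝ] (TangentSpace (dualModel E F) (⟨x, 0⟩ : DualTotal F A) →L[ℝ] ℝ) where
  toFun ℓ := (ℓ.comp (ContinuousLinearMap.fst ℝ E (F →L[ℝ] ℝ)) : E × (F →L[ℝ] ℝ) →L[ℝ] ℝ)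
  map_add' _ _ := rfl
  map_smul' _ _ := rfl

theorem mvfderiv_sectionFunction_eq_verticalCovector (μ : Sections E F A) (x : M) :
    mvfderiv (dualModel E F) (sectionFunction μ) ⟨x, 0⟩ =
      verticalCovector E F A x (fiberCoord x (μ x)) :=
  ContinuousLinearMap.ext fun w => mvfderiv_sectionFunction_zero μ x w

theorem mvfderiv_comp_proj_eq_baseCovector {f : M → ℝ} (hf : ContMDiff 𝓘(ℝ, E) 𝓘(ℝ, ℝ) ∞ f)
    (x : M) :
    mvfderiv (dualModel E F) (f ∘ TotalSpace.proj) (⟨x, 0⟩ : DualTotal F A) =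
      baseCovector E F A x (mvfderiv 𝓘(ℝ, E) f x) :=
  ContinuousLinearMap.ext fun w => mvfderiv_comp_proj hf _ w

namespace JacobiStructure

variable (S : JacobiStructure (dualModel E F) (DualTotal F A))

/-- The linear form on `A_x` given by minus the vertical part of the vector field of a Jacobi
structure on `A^*` at the zero of `A_x^*`. -/
def cocycleAt (x : M) : A x →L[ℝ] ℝ :=
  ContinuousLinearMap.comp (-(show E × (F →L[ℝ] ℝ) from S.field ⟨x, 0⟩).2) (fiberCoord x)

theorem cocycleAt_apply (μ : Sections E F A) (x : M) :
    S.cocycleAt x (μ x) = -applyField S.field (sectionFunction μ) ⟨x, 0⟩ := by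
  rw [applyField, mvfderiv_sectionFunction_eq_verticalCovector]
  rfl

/-- The 1-cocycle of a Jacobi structure on `A^*`. -/
def cocycle : DualSections E F A :=
  ⟨S.cocycleAt, contMDiff_hom_of_forall (B := Bundle.Trivial M ℝ) S.cocycleAt fun μ x => by
    refine (contMDiffAt_section (E := Bundle.Trivial M ℝ) x).2 ?_
    have h := (contMDiff_applyField S.field (contMDiff_sectionFunction μ)).comp_dual_zero.neg x
    refine h.congr_of_eventuallyEq (Filter.Eventually.of_forall fun y => ?_)
    exact S.cocycleAt_apply μ y⟩

theorem cocycle_apply (C2 : S.BracketOneIsBasic) (μ : Sections E F A) (p : DualTotal F A) :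
    applyField S.field (sectionFunction μ) p = -S.cocycle p.proj (μ p.proj) := by
  rw [S.applyField_sectionFunction_eq C2]
  have := S.cocycleAt_apply μ p.proj
  rw [show S.cocycle p.proj (μ p.proj) = S.cocycleAt p.proj (μ p.proj) from rfl, this, neg_neg]

/-- The anchor of a Jacobi structure on `A^*`, in the trivialization at `x`. -/
def anchorModelAt (x : M) : F →ₗ[ℝ] E where
  toFun a := ∑ l, S.bivector.toFun ⟨x, 0⟩ (verticalCovector E F A x a)
    (baseCovector E F A x (LinearMap.toContinuousLinearMap ((Module.finBasis ℝ E).coord l))) •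
      Module.finBasis ℝ E l
  map_add' a b := by simp [add_smul, Finset.sum_add_distrib]
  map_smul' c a := by simp [mul_smul, Finset.smul_sum]

/-- Expanding `ℓ` in the dual basis shows that the basis used in the definition plays no role. -/
theorem clm_anchorModelAt (x : M) (a : F) (ℓ : E →L[ℝ] ℝ) :
    ℓ (S.anchorModelAt x a) =
      S.bivector.toFun ⟨x, 0⟩ (verticalCovector E F A x a) (baseCovector E F A x ℓ) := by
  have hℓ : ℓ = ∑ l, ℓ (Module.finBasis ℝ E l) •
      LinearMap.toContinuousLinearMap ((Module.finBasis ℝ E).coord l) := by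
    ext v
    rw [ℓ.apply_eq_sum_basis (Module.finBasis ℝ E)]
    simp [mul_comm]
  conv_rhs => rw [hℓ]
  simp only [anchorModelAt, LinearMap.coe_mk, AddHom.coe_mk, map_sum, map_smul, smul_eq_mul]
  exact Finset.sum_congr rfl fun l _ => mul_comm _ _

/-- The anchor of a Jacobi structure on `A^*`, on the fibre over `x`. -/
def anchorAt (x : M) : A x →L[ℝ] TangentSpace 𝓘(ℝ, E) x :=
  (LinearMap.toContinuousLinearMap (S.anchorModelAt x)).comp (fiberCoord x)

theorem mvfderiv_anchorAt (μ : Sections E F A) {f : M → ℝ}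
    (hf : ContMDiff 𝓘(ℝ, E) 𝓘(ℝ, ℝ) ∞ f) (x : M) :
    mvfderiv 𝓘(ℝ, E) f x (S.anchorAt x (μ x)) =
      S.bivector.onFun (sectionFunction μ) (f ∘ TotalSpace.proj) ⟨x, 0⟩ := by
  rw [BivectorField.onFun, mvfderiv_sectionFunction_eq_verticalCovector,
    mvfderiv_comp_proj_eq_baseCovector hf]
  exact S.clm_anchorModelAt x (fiberCoord x (μ x)) (mvfderiv 𝓘(ℝ, E) f x)

/-- The anchor of a Jacobi structure on `A^*`. -/
def anchor : Cₛ^∞⟮𝓘(ℝ, E); F →L[ℝ] E, fun x : M => A x →L[ℝ] TangentSpace 𝓘(ℝ, E) x⟯ :=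
  ⟨S.anchorAt, contMDiff_hom_of_forall S.anchorAt fun μ =>
    contMDiff_vectorField_of_forall fun f hf => by
      simp only [S.mvfderiv_anchorAt μ hf]
      exact (S.bivector.contMDiff_onFun (contMDiff_sectionFunction μ)
        hf.comp_dual_proj).comp_dual_zero⟩

/-- The derivative of `f` along the image of `μ` under the anchor. -/
def anchorDeriv (μ : Sections E F A) (f : M → ℝ) : M → ℝ :=
  fun x => mvfderiv 𝓘(ℝ, E) f x (S.anchor x (μ x))

theorem contMDiff_anchorDeriv (μ : Sections E F A) {f : M → ℝ}
    (hf : ContMDiff 𝓘(ℝ, E) 𝓘(ℝ, ℝ) ∞ f) : ContMDiff 𝓘(ℝ, E) 𝓘(ℝ, ℝ) ∞ (S.anchorDeriv μ f) := by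
  have : S.anchorDeriv μ f = fun x =>
      S.bivector.onFun (sectionFunction μ) (f ∘ TotalSpace.proj) ⟨x, 0⟩ :=
    funext fun x => S.mvfderiv_anchorAt μ hf x
  rw [this]
  exact (S.bivector.contMDiff_onFun (contMDiff_sectionFunction μ) hf.comp_dual_proj).comp_dual_zero

theorem onFun_sectionFunction_comp_proj (hrank : 0 < Module.finrank ℝ F) (C1 : S.BracketIsLinear)
    (C2 : S.BracketOneIsBasic) (μ : Sections E F A) {f : M → ℝ}
    (hf : ContMDiff 𝓘(ℝ, E) 𝓘(ℝ, ℝ) ∞ f) (p : DualTotal F A) :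
    S.bivector.onFun (sectionFunction μ) (f ∘ TotalSpace.proj) p = S.anchorDeriv μ f p.proj := by
  rw [S.onFun_sectionFunction_comp_proj_eq hrank C1 C2 μ hf]
  exact (S.mvfderiv_anchorAt μ hf p.proj).symm

/-- The section whose linear function is the Jacobi bracket of the linear functions of two
sections. -/
def sectionBracket (C1 : S.BracketIsLinear) (μ η : Sections E F A) : Sections E F A :=
  (exists_section_of_isLinearFunction (C1 _ _ (isLinearFunction_sectionFunction μ)
    (isLinearFunction_sectionFunction η))).choose

theorem sectionFunction_sectionBracket (C1 : S.BracketIsLinear) (μ η : Sections E F A) :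
    sectionFunction (S.sectionBracket C1 μ η) =
      S.bracket (sectionFunction μ) (sectionFunction η) :=
  funext fun p => ((exists_section_of_isLinearFunction (C1 _ _ (isLinearFunction_sectionFunction μ)
    (isLinearFunction_sectionFunction η))).choose_spec p).symm

theorem sectionBracket_swap (C1 : S.BracketIsLinear) (μ η : Sections E F A) :
    S.sectionBracket C1 μ η = -S.sectionBracket C1 η μ := by
  refine section_ext fun p => ?_
  rw [← neg_one_smul ℝ, sectionFunction_smul, Pi.smul_apply, S.sectionFunction_sectionBracket,
    S.sectionFunction_sectionBracket, S.bracket_swap]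
  simp

theorem sectionBracket_add_right (C1 : S.BracketIsLinear) (μ η ζ : Sections E F A) :
    S.sectionBracket C1 μ (η + ζ) = S.sectionBracket C1 μ η + S.sectionBracket C1 μ ζ := by
  refine section_ext fun p => ?_
  simp only [sectionFunction_add, S.sectionFunction_sectionBracket, Pi.add_apply]
  exact S.bracket_add_right (contMDiff_sectionFunction η) (contMDiff_sectionFunction ζ) p

theorem sectionBracket_smul_right (C1 : S.BracketIsLinear) (c : ℝ) (μ η : Sections E F A) :
    S.sectionBracket C1 μ (c • η) = c • S.sectionBracket C1 μ η := by
  refine section_ext fun p => ?_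
  simp only [sectionFunction_smul, S.sectionFunction_sectionBracket, Pi.smul_apply, smul_eq_mul]
  exact S.bracket_const_smul_right c (contMDiff_sectionFunction η) p

/-- The bracket of sections of `A` defined by a Jacobi structure on `A^*`, as a bilinear map. -/
def sectionBracketBilin (C1 : S.BracketIsLinear) :
    Sections E F A →ₗ[ℝ] Sections E F A →ₗ[ℝ] Sections E F A :=
  LinearMap.mk₂ ℝ (S.sectionBracket C1)
    (fun μ η ζ => by
      rw [S.sectionBracket_swap, S.sectionBracket_add_right, S.sectionBracket_swap C1 μ,
        S.sectionBracket_swap C1 η, neg_add])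
    (fun c μ η => by
      rw [S.sectionBracket_swap, S.sectionBracket_smul_right, S.sectionBracket_swap C1 μ,
        smul_neg])
    (fun μ η ζ => S.sectionBracket_add_right C1 μ η ζ)
    (fun c μ η => S.sectionBracket_smul_right C1 c μ η)

/-- The first-order operator `ρ(μ) + φ(μ)` on functions on `M`. -/
def twistedDeriv (μ : Sections E F A) (f : M → ℝ) : M → ℝ :=
  fun x => S.anchorDeriv μ f x + f x * S.cocycle x (μ x)

theorem contMDiff_cocycle_apply (μ : Sections E F A) :
    ContMDiff 𝓘(ℝ, E) 𝓘(ℝ, ℝ) ∞ (fun x => S.cocycle x (μ x)) := by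
  have : (fun x => S.cocycle x (μ x)) =
      fun x => -applyField S.field (sectionFunction μ) ⟨x, 0⟩ :=
    funext fun x => S.cocycleAt_apply μ x
  rw [this]
  exact (contMDiff_applyField S.field (contMDiff_sectionFunction μ)).comp_dual_zero.neg

theorem contMDiff_twistedDeriv (μ : Sections E F A) {f : M → ℝ}
    (hf : ContMDiff 𝓘(ℝ, E) 𝓘(ℝ, ℝ) ∞ f) : ContMDiff 𝓘(ℝ, E) 𝓘(ℝ, ℝ) ∞ (S.twistedDeriv μ f) :=
  (S.contMDiff_anchorDeriv μ hf).add (hf.mul (S.contMDiff_cocycle_apply μ))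

/-- Brackets of linear with basic functions are again basic, so they can be iterated in the Jacobi
identity. -/
theorem bracket_sectionFunction_comp_proj (hrank : 0 < Module.finrank ℝ F)
    (C1 : S.BracketIsLinear) (C2 : S.BracketOneIsBasic) (μ : Sections E F A) {f : M → ℝ}
    (hf : ContMDiff 𝓘(ℝ, E) 𝓘(ℝ, ℝ) ∞ f) :
    S.bracket (sectionFunction μ) (f ∘ TotalSpace.proj) =
      S.twistedDeriv μ f ∘ TotalSpace.proj := by
  ext p
  rw [S.bracket_apply, S.onFun_sectionFunction_comp_proj hrank C1 C2 μ hf,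
    S.applyField_comp_proj hrank C2 hf, S.cocycle_apply C2]
  simp only [twistedDeriv, Function.comp]
  ring

/-- This is the Jacobi identity for two linear functions and one basic function, read on the zero
section. -/
theorem twistedDeriv_sectionBracket (hrank : 0 < Module.finrank ℝ F)
    (C1 : S.BracketIsLinear) (C2 : S.BracketOneIsBasic) (μ η : Sections E F A) {f : M → ℝ}
    (hf : ContMDiff 𝓘(ℝ, E) 𝓘(ℝ, ℝ) ∞ f) (x : M) :
    S.twistedDeriv (S.sectionBracket C1 μ η) f x =
      S.twistedDeriv μ (S.twistedDeriv η f) x - S.twistedDeriv η (S.twistedDeriv μ f) x := by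
  have hfp := hf.comp_dual_proj (F := F) (A := A)
  have hb (μ : Sections E F A) {f : M → ℝ} (hf : ContMDiff 𝓘(ℝ, E) 𝓘(ℝ, ℝ) ∞ f) :=
    S.bracket_sectionFunction_comp_proj hrank C1 C2 μ hf
  have h := S.jacobi_identity (contMDiff_sectionFunction μ) (contMDiff_sectionFunction η) hfp
    ⟨x, 0⟩
  have e : S.bracket (f ∘ TotalSpace.proj) (sectionFunction μ) =
      (-1 : ℝ) • (S.twistedDeriv μ f ∘ TotalSpace.proj) := by
    ext q
    rw [S.bracket_swap, hb μ hf]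
    simp
  rw [hb η hf, hb μ (S.contMDiff_twistedDeriv η hf), e,
    S.bracket_const_smul_right _ (S.contMDiff_twistedDeriv μ hf).comp_dual_proj,
    hb η (S.contMDiff_twistedDeriv μ hf), S.bracket_swap (f ∘ _),
    ← S.sectionFunction_sectionBracket C1, hb _ hf] at h
  simp only [Function.comp] at h
  linarith

theorem anchorDeriv_const (μ : Sections E F A) (c : ℝ) (x : M) :
    S.anchorDeriv μ (fun _ => c) x = 0 := by
  simp [anchorDeriv, mvfderiv_const]

theorem anchorDeriv_add (μ : Sections E F A) {f g : M → ℝ}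
    (hf : ContMDiff 𝓘(ℝ, E) 𝓘(ℝ, ℝ) ∞ f) (hg : ContMDiff 𝓘(ℝ, E) 𝓘(ℝ, ℝ) ∞ g) (x : M) :
    S.anchorDeriv μ (f + g) x = S.anchorDeriv μ f x + S.anchorDeriv μ g x := by
  simp [anchorDeriv,
    mvfderiv_add (hf.mdifferentiableAt_of_smooth x) (hg.mdifferentiableAt_of_smooth x)]

theorem anchorDeriv_mul (μ : Sections E F A) {f g : M → ℝ}
    (hf : ContMDiff 𝓘(ℝ, E) 𝓘(ℝ, ℝ) ∞ f) (hg : ContMDiff 𝓘(ℝ, E) 𝓘(ℝ, ℝ) ∞ g) (x : M) :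
    S.anchorDeriv μ (f * g) x = f x * S.anchorDeriv μ g x + g x * S.anchorDeriv μ f x := by
  simp [anchorDeriv,
    mvfderiv_mul (hf.mdifferentiableAt_of_smooth x) (hg.mdifferentiableAt_of_smooth x)]

/-- The commutator identity at `f = 1`, where `ρ(μ) + φ(μ)` reduces to multiplication by `φ(μ)`. -/
theorem cocycle_sectionBracket (hrank : 0 < Module.finrank ℝ F)
    (C1 : S.BracketIsLinear) (C2 : S.BracketOneIsBasic) (μ η : Sections E F A) (x : M) :
    S.cocycle x (S.sectionBracket C1 μ η x) =
      S.anchorDeriv μ (fun y => S.cocycle y (η y)) x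
        - S.anchorDeriv η (fun y => S.cocycle y (μ y)) x := by
  have h := S.twistedDeriv_sectionBracket hrank C1 C2 μ η (f := fun _ => 1) contMDiff_const x
  have e (μ : Sections E F A) : S.twistedDeriv μ (fun _ => 1) = fun y => S.cocycle y (μ y) := by
    ext y
    simp [twistedDeriv, anchorDeriv_const]
  rw [e, e, e] at h
  simp only [twistedDeriv] at h
  linarith

/-- In the commutator of `ρ(μ) + φ(μ)` and `ρ(η) + φ(η)` the mixed first-order terms cancel, and the
terms proportional to `f` are accounted for by the cocycle identity. -/
theorem anchorDeriv_sectionBracket (hrank : 0 < Module.finrank ℝ F)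
    (C1 : S.BracketIsLinear) (C2 : S.BracketOneIsBasic) (μ η : Sections E F A) {f : M → ℝ}
    (hf : ContMDiff 𝓘(ℝ, E) 𝓘(ℝ, ℝ) ∞ f) (x : M) :
    S.anchorDeriv (S.sectionBracket C1 μ η) f x =
      S.anchorDeriv μ (S.anchorDeriv η f) x - S.anchorDeriv η (S.anchorDeriv μ f) x := by
  have h := S.twistedDeriv_sectionBracket hrank C1 C2 μ η hf x
  have hc := S.cocycle_sectionBracket hrank C1 C2 μ η x
  have e (μ η : Sections E F A) : S.twistedDeriv μ (S.twistedDeriv η f) x =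
      S.anchorDeriv μ (S.anchorDeriv η f) x
      + (f x * S.anchorDeriv μ (fun y => S.cocycle y (η y)) x
        + S.cocycle x (η x) * S.anchorDeriv μ f x)
      + (S.anchorDeriv η f x + f x * S.cocycle x (η x)) * S.cocycle x (μ x) := by
    rw [twistedDeriv, show S.twistedDeriv η f = S.anchorDeriv η f +
      f * (fun y => S.cocycle y (η y)) from rfl, S.anchorDeriv_add μ
      (S.contMDiff_anchorDeriv η hf) (hf.mul (S.contMDiff_cocycle_apply η)),
      S.anchorDeriv_mul μ hf (S.contMDiff_cocycle_apply η)]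
    rfl
  rw [e, e, twistedDeriv, hc] at h
  linear_combination h

/-- The Lie algebroid structure on `A` defined by a Jacobi structure on `A^*`. -/
def lieAlgebroid (hrank : 0 < Module.finrank ℝ F)
    (C1 : S.BracketIsLinear) (C2 : S.BracketOneIsBasic) : LieAlgebroid E F A where
  bracket := S.sectionBracketBilin C1
  bracket_self μ := section_ext fun p => by
    change sectionFunction (S.sectionBracket C1 μ μ) p = _
    rw [S.sectionFunction_sectionBracket, S.bracket_self]
    exact (map_zero p.snd).symm
  jacobi μ η ζ := section_ext fun p => by
    change sectionFunction (S.sectionBracket C1 μ (S.sectionBracket C1 η ζ)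
      + S.sectionBracket C1 η (S.sectionBracket C1 ζ μ)
      + S.sectionBracket C1 ζ (S.sectionBracket C1 μ η)) p = _
    simp only [sectionFunction_add, S.sectionFunction_sectionBracket, Pi.add_apply]
    rw [S.jacobi_identity (contMDiff_sectionFunction μ) (contMDiff_sectionFunction η)
      (contMDiff_sectionFunction ζ)]
    exact (map_zero p.snd).symm
  anchor := S.anchor
  anchor_bracket μ η x := tangentVector_ext fun f hf => by
    let X (μ : Sections E F A) : Cₛ^∞⟮𝓘(ℝ, E); E, (TangentSpace 𝓘(ℝ, E) : M → Type _)⟯ :=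
      ⟨fun y => S.anchor y (μ y), ContMDiff.clm_bundle_apply S.anchor.contMDiff μ.contMDiff⟩
    exact (S.anchorDeriv_sectionBracket hrank C1 C2 μ η hf x).trans
      (mvfderiv_mlieBracket (X μ) (X η) hf x).symm
  leibniz f hf μ η x := dual_ext (F := F) fun α => by
    have hfp := hf.comp_dual_proj (F := F) (A := A)
    have h := congrFun (S.sectionFunction_sectionBracket C1 μ (smulSection f hf η)) ⟨x, α⟩
    rw [sectionFunction_smulSection, S.bracket_mul_right hfp (contMDiff_sectionFunction η),
      S.onFun_sectionFunction_comp_proj hrank C1 C2 μ hf, S.applyField_comp_proj hrank C2 hf,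
      ← S.sectionFunction_sectionBracket C1] at h
    refine Eq.trans h ?_
    rw [map_add, map_smul, map_smul]
    simp only [sectionFunction, Function.comp, smul_eq_mul, mul_zero, add_zero, anchorDeriv]
    rw [mul_comm (α (η x))]
    rfl

theorem isCocycle_cocycle (hrank : 0 < Module.finrank ℝ F)
    (C1 : S.BracketIsLinear) (C2 : S.BracketOneIsBasic) :
    (S.lieAlgebroid hrank C1 C2).IsCocycle S.cocycle :=
  fun μ η x => S.cocycle_sectionBracket hrank C1 C2 μ η x

end JacobiStructure

end AlgebroidOfJacobi

/-! ### The Jacobi structure of a Lie algebroid with a 1-cocycle in coordinates -/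

section Wedge

variable {E : Type*} [NormedAddCommGroup E] [NormedSpace ℝ E] {H : Type*} [TopologicalSpace H]
  (J : ModelWithCorners ℝ E H) {N : Type*} [TopologicalSpace N] [ChartedSpace H N]

theorem wedge_apply {p : N} (X Y : TangentSpace J p) (ξ ζ : TangentSpace J p →L[ℝ] ℝ) :
    wedge J X Y ξ ζ = ξ X * ζ Y - ξ Y * ζ X := rfl

end Wedge

section DualBivector

variable {E : Type*} [NormedAddCommGroup E] [NormedSpace ℝ E]
  {M : Type*} [TopologicalSpace M] [ChartedSpace E M] [IsManifold 𝓘(ℝ, E) ∞ M]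
  {F : Type*} [NormedAddCommGroup F] [NormedSpace ℝ F]
  {A : M → Type*} [TopologicalSpace (TotalSpace F A)] [∀ x, AddCommGroup (A x)]
  [∀ x, Module ℝ (A x)] [∀ x, TopologicalSpace (A x)] [FiberBundle F A] [VectorBundle ℝ F A]

theorem LieAlgebroid.bracket_swap (L : LieAlgebroid E F A) (μ η : Sections E F A) :
    L.bracket μ η = -L.bracket η μ := by
  have h := L.bracket_self (μ + η)
  simp only [map_add, LinearMap.add_apply, L.bracket_self, zero_add, add_zero] at h
  rw [add_comm] at h
  exact eq_neg_of_add_eq_zero_left h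

variable [FiniteDimensional ℝ E] [T2Space M] [FiniteDimensional ℝ F]
  [ContMDiffVectorBundle ∞ F A 𝓘(ℝ, E)]

theorem mvfderiv_frame_partialMu (p : DualTotal F A) (a i : Fin (Module.finrank ℝ F)) :
    mvfderiv (dualModel E F) (sectionFunction (frame E F A p.proj a)) p (partialMu E p i) =
      if a = i then 1 else 0 := by
  rw [partialMu, mvfderiv_sectionFunction_frame]
  simp [Finsupp.single_apply]

theorem mvfderiv_frame_partialX (p : DualTotal F A) (a : Fin (Module.finrank ℝ F))
    (l : Fin (Module.finrank ℝ E)) :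
    mvfderiv (dualModel E F) (sectionFunction (frame E F A p.proj a)) p (partialX E p l) = 0 := by
  rw [partialX, mvfderiv_sectionFunction_frame]
  rfl

theorem mvfderiv_comp_proj_partialMu {f : M → ℝ} (hf : ContMDiff 𝓘(ℝ, E) 𝓘(ℝ, ℝ) ∞ f)
    (p : DualTotal F A) (i : Fin (Module.finrank ℝ F)) :
    mvfderiv (dualModel E F) (f ∘ TotalSpace.proj) p (partialMu E p i) = 0 := by
  rw [partialMu, mvfderiv_comp_proj hf]
  exact map_zero _

theorem mvfderiv_comp_proj_partialX {f : M → ℝ} (hf : ContMDiff 𝓘(ℝ, E) 𝓘(ℝ, ℝ) ∞ f)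
    (p : DualTotal F A) (l : Fin (Module.finrank ℝ E)) :
    mvfderiv (dualModel E F) (f ∘ TotalSpace.proj) p (partialX E p l) =
      mvfderiv 𝓘(ℝ, E) f p.proj (Module.finBasis ℝ E l) := by
  rw [partialX, mvfderiv_comp_proj hf]

namespace LieAlgebroid

variable (L : LieAlgebroid E F A)

theorem sum_structureFunction (p : DualTotal F A) (i j : Fin (Module.finrank ℝ F)) :
    ∑ k, L.structureFunction p.proj i j k * p.snd (frame E F A p.proj k p.proj) =
      p.snd (L.bracket (frame E F A p.proj i) (frame E F A p.proj j) p.proj) := by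
  rw [p.snd.apply_eq_sum_basis ((trivializationAt F A p.proj).basisAt (Module.finBasis ℝ F)
    (mem_baseSet_trivializationAt F A p.proj))
    (L.bracket (frame E F A p.proj i) (frame E F A p.proj j) p.proj)]
  refine Finset.sum_congr rfl fun k _ => ?_
  rw [frame_self, structureFunction, smul_eq_mul]

theorem sum_anchorComponent (x : M) (i : Fin (Module.finrank ℝ F)) (ℓ : E →L[ℝ] ℝ) :
    ∑ l, L.anchorComponent x i l * ℓ (Module.finBasis ℝ E l) =
      ℓ (L.anchor x (frame E F A x i x)) :=
  (ℓ.apply_eq_sum_basis (Module.finBasis ℝ E) (L.anchor x (frame E F A x i x))).symm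

theorem linearPoisson_apply (p : DualTotal F A)
    (ξ ζ : TangentSpace (dualModel E F) p →L[ℝ] ℝ) :
    L.linearPoisson p ξ ζ =
      (∑ i, ∑ j ∈ Finset.Ioi i,
        p.snd (L.bracket (frame E F A p.proj i) (frame E F A p.proj j) p.proj) *
        (ξ (partialMu E p i) * ζ (partialMu E p j) - ξ (partialMu E p j) * ζ (partialMu E p i)))
      + ∑ i, ∑ l, L.anchorComponent p.proj i l *
        (ξ (partialMu E p i) * ζ (partialX E p l) - ξ (partialX E p l) * ζ (partialMu E p i)) := by
  simp only [linearPoisson, LinearMap.add_apply, LinearMap.sum_apply, LinearMap.smul_apply,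
    wedge_apply, smul_eq_mul, ← sum_structureFunction, Finset.sum_mul]

theorem linearPoisson_swap (p : DualTotal F A)
    (ξ ζ : TangentSpace (dualModel E F) p →L[ℝ] ℝ) :
    L.linearPoisson p ξ ζ = -L.linearPoisson p ζ ξ := by
  rw [linearPoisson_apply, linearPoisson_apply, neg_add, ← Finset.sum_neg_distrib,
    ← Finset.sum_neg_distrib]
  congr 1 <;> refine Finset.sum_congr rfl fun i _ => ?_ <;> rw [← Finset.sum_neg_distrib] <;>
    refine Finset.sum_congr rfl fun j _ => ?_ <;> ring

/-- The vectors `∂/∂μ_i` are dual to the differentials of the frame functions, so for `a < b` a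
single term of the sum survives; antisymmetry covers the other order. -/
theorem linearPoisson_frame_frame (p : DualTotal F A) (a b : Fin (Module.finrank ℝ F)) :
    L.linearPoisson p
      (mvfderiv (dualModel E F) (sectionFunction (frame E F A p.proj a)) p)
      (mvfderiv (dualModel E F) (sectionFunction (frame E F A p.proj b)) p) =
      p.snd (L.bracket (frame E F A p.proj a) (frame E F A p.proj b) p.proj) := by
  wlog hab : a ≤ b generalizing a b
  · rw [linearPoisson_swap, this b a (le_of_not_ge hab), L.bracket_swap (frame E F A p.proj a)]
    exact (map_neg p.snd _).symm
  rw [linearPoisson_apply]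
  simp only [mvfderiv_frame_partialMu, mvfderiv_frame_partialX, mul_zero, zero_mul, sub_zero,
    Finset.sum_const_zero, add_zero]
  rcases hab.eq_or_lt with rfl | hlt
  · rw [L.bracket_self]
    rw [show (0 : Sections E F A) p.proj = 0 from rfl, map_zero]
    refine Finset.sum_eq_zero fun i _ => Finset.sum_eq_zero fun j _ => ?_
    ring
  · rw [Finset.sum_eq_single a, Finset.sum_eq_single b]
    · simp [hlt.ne']
    · intro j _ hj
      rcases eq_or_ne a j with rfl | h
      · simp_all
      · simp [h, hj.symm]
    · intro h
      simp [hlt] at h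
    · intro i _ hi
      refine Finset.sum_eq_zero fun j hj => ?_
      have hij : i < j := Finset.mem_Ioi.1 hj
      rcases eq_or_ne b i with rfl | h
      · simp [hi.symm, (hlt.trans hij).ne]
      · simp [hi.symm, h]
    · simp

theorem linearPoisson_frame_comp_proj (p : DualTotal F A) (a : Fin (Module.finrank ℝ F))
    {f : M → ℝ} (hf : ContMDiff 𝓘(ℝ, E) 𝓘(ℝ, ℝ) ∞ f) :
    L.linearPoisson p
      (mvfderiv (dualModel E F) (sectionFunction (frame E F A p.proj a)) p)
      (mvfderiv (dualModel E F) (f ∘ TotalSpace.proj) p) =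
      mvfderiv 𝓘(ℝ, E) f p.proj (L.anchor p.proj (frame E F A p.proj a p.proj)) := by
  rw [linearPoisson_apply]
  simp only [mvfderiv_frame_partialMu, mvfderiv_frame_partialX, mvfderiv_comp_proj_partialMu hf,
    mvfderiv_comp_proj_partialX hf, mul_zero, sub_zero, Finset.sum_const_zero, zero_add, ite_mul,
    one_mul, zero_mul, mul_ite]
  rw [Finset.sum_eq_single a]
  · simp only [if_true]
    exact L.sum_anchorComponent p.proj a (mvfderiv 𝓘(ℝ, E) f p.proj)
  · intro i _ hi
    simp [hi.symm]
  · simp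

theorem linearPoisson_comp_proj_comp_proj (p : DualTotal F A)
    {f g : M → ℝ} (hf : ContMDiff 𝓘(ℝ, E) 𝓘(ℝ, ℝ) ∞ f) (hg : ContMDiff 𝓘(ℝ, E) 𝓘(ℝ, ℝ) ∞ g) :
    L.linearPoisson p (mvfderiv (dualModel E F) (f ∘ TotalSpace.proj) p)
      (mvfderiv (dualModel E F) (g ∘ TotalSpace.proj) p) = 0 := by
  rw [linearPoisson_apply]
  simp [mvfderiv_comp_proj_partialMu hf, mvfderiv_comp_proj_partialMu hg]

end LieAlgebroid

/-! ### Comparison of the given Jacobi structure with the coordinate formulas. -/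

namespace JacobiStructure

variable (S : JacobiStructure (dualModel E F) (DualTotal F A))

/-- Both vectors annihilate basic functions and send `μ~` to `-φ(μ)`. -/
theorem field_eq_dualField (hrank : 0 < Module.finrank ℝ F) (C2 : S.BracketOneIsBasic)
    (p : DualTotal F A) : S.field p = dualField S.cocycle p := by
  let ev (w : TangentSpace (dualModel E F) p) :
      (TangentSpace (dualModel E F) p →L[ℝ] ℝ) →ₗ[ℝ] ℝ :=
    { toFun := fun ξ => ξ w, map_add' := fun _ _ => rfl, map_smul' := fun _ _ => rfl }
  have h : ev (S.field p) = ev (dualField S.cocycle p) := by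
    refine covector_linearMap_ext (fun f hf => ?_) fun i => ?_
    · change applyField S.field (f ∘ TotalSpace.proj) p =
        mvfderiv (dualModel E F) (f ∘ TotalSpace.proj) p (-verticalVector E p _)
      rw [S.applyField_comp_proj hrank C2 hf, ContinuousLinearMap.map_neg, mvfderiv_comp_proj_verticalVector hf,
        neg_zero]
    · change applyField S.field (sectionFunction (frame E F A p.proj i)) p =
        mvfderiv (dualModel E F) (sectionFunction (frame E F A p.proj i)) p (-verticalVector E p _)
      rw [S.cocycle_apply C2, ContinuousLinearMap.map_neg, mvfderiv_sectionFunction_verticalVector]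
  refine (SeparatingDual.eq_iff_forall_dual_eq (R := ℝ) (V := E × (F →L[ℝ] ℝ))).2 fun ξ => ?_
  exact LinearMap.congr_fun h ξ

/-- On two linear functions, `Λ(dμ~, dη~) = {μ~, η~} - μ~ E(η~) + η~ E(μ~)`; substituting `E = -φ`
turns the last two terms into `(Δ ∧ φ^v)(dμ~, dη~)`. If one argument is basic, the term `Δ ∧ φ^v`
vanishes, both of its factors being vertical. -/
theorem bivector_eq_dualBivector (hrank : 0 < Module.finrank ℝ F) (C1 : S.BracketIsLinear)
    (C2 : S.BracketOneIsBasic) (p : DualTotal F A) :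
    S.bivector.toFun p = (S.lieAlgebroid hrank C1 C2).dualBivector S.cocycle p := by
  set L := S.lieAlgebroid hrank C1 C2 with hL
  have swap (ξ ζ) : L.dualBivector S.cocycle p ξ ζ = -L.dualBivector S.cocycle p ζ ξ := by
    simp only [LieAlgebroid.dualBivector, LinearMap.add_apply, wedge_apply]
    rw [L.linearPoisson_swap]
    ring
  have mixed (i) {f : M → ℝ} (hf : ContMDiff 𝓘(ℝ, E) 𝓘(ℝ, ℝ) ∞ f) :
      S.bivector.toFun p (mvfderiv (dualModel E F) (sectionFunction (frame E F A p.proj i)) p)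
        (mvfderiv (dualModel E F) (f ∘ TotalSpace.proj) p) =
      L.dualBivector S.cocycle p
        (mvfderiv (dualModel E F) (sectionFunction (frame E F A p.proj i)) p)
        (mvfderiv (dualModel E F) (f ∘ TotalSpace.proj) p) := by
    rw [LieAlgebroid.dualBivector, LinearMap.add_apply, LinearMap.add_apply, wedge_apply,
      L.linearPoisson_frame_comp_proj p i hf, liouville, verticalLift,
      mvfderiv_comp_proj_verticalVector hf, mvfderiv_comp_proj_verticalVector hf]
    simp only [mul_zero, sub_zero, add_zero]
    exact S.onFun_sectionFunction_comp_proj hrank C1 C2 _ hf p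
  refine covector_linearMap_ext (fun f hf => ?_) fun i => ?_
  · refine covector_linearMap_ext (fun g hg => ?_) fun j => ?_
    · rw [LieAlgebroid.dualBivector, LinearMap.add_apply, LinearMap.add_apply, wedge_apply,
        L.linearPoisson_comp_proj_comp_proj p hf hg, liouville, verticalLift,
        mvfderiv_comp_proj_verticalVector hf, mvfderiv_comp_proj_verticalVector hf]
      simp only [zero_mul, sub_zero, add_zero]
      exact S.onFun_comp_proj_comp_proj hrank C1 C2 hf hg p
    · rw [swap, S.bivector.toFun_swap, mixed j hf]
  · refine covector_linearMap_ext (fun g hg => mixed i hg) fun j => ?_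
    rw [LieAlgebroid.dualBivector, LinearMap.add_apply, LinearMap.add_apply, wedge_apply,
      L.linearPoisson_frame_frame, liouville, verticalLift]
    simp only [mvfderiv_sectionFunction_verticalVector]
    have h := congrFun (S.sectionFunction_sectionBracket C1 (frame E F A p.proj i)
      (frame E F A p.proj j)) p
    rw [S.bracket_apply, S.cocycle_apply C2, S.cocycle_apply C2] at h
    change S.bivector.onFun _ _ p = sectionFunction (S.sectionBracket C1 _ _) p + _
    rw [h]
    simp only [sectionFunction]
    ring

end JacobiStructure

end DualBivector

end

theorem theorem2
    {E : Type*} [NormedAddCommGroup E] [NormedSpace ℝ E] [FiniteDimensional ℝ E]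
    {M : Type*} [TopologicalSpace M] [T2Space M] [ChartedSpace E M] [IsManifold 𝓘(ℝ, E) ∞ M]
    {F : Type*} [NormedAddCommGroup F] [NormedSpace ℝ F] [FiniteDimensional ℝ F]
    (hrank : 0 < Module.finrank ℝ F)
    {A : M → Type*} [TopologicalSpace (TotalSpace F A)] [∀ x, AddCommGroup (A x)]
    [∀ x, Module ℝ (A x)] [∀ x, TopologicalSpace (A x)] [FiberBundle F A] [VectorBundle ℝ F A]
    [ContMDiffVectorBundle ∞ F A 𝓘(ℝ, E)]
    (S : JacobiStructure (dualModel E F) (DualTotal F A))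
    (C1 : ∀ f g : DualTotal F A → ℝ, IsLinearFunction E f → IsLinearFunction E g →
      IsLinearFunction E (S.bracket f g))
    (C2 : ∀ f : DualTotal F A → ℝ, IsLinearFunction E f →
      IsBasicFunction E (S.bracket f 1)) :
    ∃ (L : LieAlgebroid E F A) (φ : DualSections E F A), L.IsCocycle φ ∧
      (∀ p : DualTotal F A, S.bivector.toFun p = L.dualBivector φ p) ∧
      (∀ p : DualTotal F A, S.field p = dualField φ p) := by
  exact ⟨S.lieAlgebroid hrank C1 C2, S.cocycle, S.isCocycle_cocycle hrank C1 C2,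
    S.bivector_eq_dualBivector hrank C1 C2, S.field_eq_dualField hrank C2⟩
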